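/- Let $K$ be a field of characteristic zero and let $R$ be a finitely generated $K$-subalgebra of a polynomial ring over $K$ that is generated by monomials. Write $D_R$ for the ring of $K$-linear differential operators on $R$ (in the sense of Grothendieck), $\operatorname{ord}$ for the order of an operator. Fix an $\mathbb{N}$-grading of the $K$-algebra $R$ with $R_0=K$ and an integer $w$ such that $R$ is generated as a $K$-algebra by homogeneous elements of degree less than $w$, and let $\mathcal{B}^\bullet$ be the corresponding Bernstein filtration on $D_R$, \[ B^i = \operatorname{span}_K\{\delta\in D_R \text{ homogeneous} \mid \deg(\delta)+w\operatorname{ord}(\delta)\le i\}\qquad(i\in\mathbb{N}). \] On $D_R\otimes_K D_R^{\mathrm{op}}$ consider the filtration $\mathcal{B}^\bullet_{\boxtimes}$ with $B^i_{\boxtimes}=B^i\otimes_K B^i$. A $K$-algebra $A$ with filtration $\mathcal{F}^\bullet$ is called linearly simple if there is a constant $C\in\mathbb{N}$ such that for every $t\in\mathbb{N}$ and every nonzero $r\in F^t$ one has $1\in F^{Ct}\,r\,F^{Ct}$, where $F^{Ct}\,r\,F^{Ct}$ is the $K$-span of all $a\,r\,b$ with $a,b\in F^{Ct}$. Suppose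 that $(D_R,\mathcal{B}^\bullet)$ is linearly simple. Then: 1. $(D_R\otimes_K D_R^{\mathrm{op}},\mathcal{B}^\bullet_{\boxtimes})$ is linearly simple. 2. Every nonzero $f\in R$ has a nonzero sandwich Bernstein–Sato polynomial. Here the sandwich Bernstein–Sato polynomial of $f$ is the monic generator (or $0$, if the ideal is zero) of the ideal of all $b(s)\in K[s]$ for which there are finitely many $\alpha_i(s),\beta_i(s)\in D_R[s]$ with \[ \sum_i \alpha_i(n)\, f^{n+1}\, \beta_i(n) = b(n)\, f^n \quad\text{in } D_R \text{ for all } n\in\mathbb{N}, \] where elements of $R$ are regarded as multiplication operators and the products are compositions of operators. -/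

import Mathlib

namespace DiffOp

section Operators

variable (K R : Type*) [CommRing K] [CommRing R] [Algebra K R]

/-- The `K`-linear differential operators on `R` of order at most `n`, in the sense of
Grothendieck: those of order at most `0` are the `R`-linear endomorphisms of `R`, and `δ` has order
at most `n + 1` when its commutator with every multiplication operator has order at most `n`. -/
def ofOrderLE : ℕ → Submodule K (Module.End K R)
  | 0 =>
    { carrier := {δ | ∀ r x : R, δ (r * x) = r * δ x}
      zero_mem' := by intro r x; simp
      add_mem' := by
        intro a b ha hb r x
        simp only [LinearMap.add_apply, ha r x, hb r x, mul_add]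
      smul_mem' := by
        intro c a ha r x
        simp only [LinearMap.smul_apply, ha r x, mul_smul_comm] }
  | n + 1 =>
    { carrier := {δ | ∀ r : R,
        δ * LinearMap.mulLeft K r - LinearMap.mulLeft K r * δ ∈ ofOrderLE n}
      zero_mem' := by
        intro r
        simp only [zero_mul, mul_zero, sub_zero]
        exact Submodule.zero_mem _
      add_mem' := by
        intro a b ha hb r
        have h := Submodule.add_mem _ (ha r) (hb r)
        rwa [sub_add_sub_comm, ← add_mul, ← mul_add] at h
      smul_mem' := by
        intro c a ha r
        have h := Submodule.smul_mem _ c (ha r)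
        rwa [smul_sub, ← smul_mul_assoc, ← mul_smul_comm] at h }

variable {K R}

theorem mem_ofOrderLE_zero {δ : Module.End K R} :
    δ ∈ ofOrderLE K R 0 ↔ ∀ r x : R, δ (r * x) = r * δ x := Iff.rfl

theorem mem_ofOrderLE_succ {n : ℕ} {δ : Module.End K R} :
    δ ∈ ofOrderLE K R (n + 1) ↔ ∀ r : R,
      δ * LinearMap.mulLeft K r - LinearMap.mulLeft K r * δ ∈ ofOrderLE K R n := Iff.rfl

theorem ofOrderLE_le_succ (n : ℕ) : ofOrderLE K R n ≤ ofOrderLE K R (n + 1) := by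
  induction n with
  | zero =>
    intro δ hδ
    rw [mem_ofOrderLE_succ]
    intro r
    have h0 : δ * LinearMap.mulLeft K r - LinearMap.mulLeft K r * δ = 0 := by
      ext x
      simp [mem_ofOrderLE_zero.1 hδ r x]
    rw [h0]
    exact Submodule.zero_mem _
  | succ n ih =>
    intro δ hδ
    rw [mem_ofOrderLE_succ] at hδ ⊢
    exact fun r => ih (hδ r)

theorem ofOrderLE_mono : Monotone (ofOrderLE K R) :=
  monotone_nat_of_le_succ ofOrderLE_le_succ

theorem mulLeft_mem_ofOrderLE (r : R) : LinearMap.mulLeft K r ∈ ofOrderLE K R 0 := by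
  rw [mem_ofOrderLE_zero]
  intro s x
  simp only [LinearMap.mulLeft_apply]
  ring

theorem mul_mem_ofOrderLE (N : ℕ) : ∀ (m n : ℕ), m + n = N → ∀ {δ ε : Module.End K R},
    δ ∈ ofOrderLE K R m → ε ∈ ofOrderLE K R n → δ * ε ∈ ofOrderLE K R N := by
  induction N with
  | zero =>
    intro m n h δ ε hδ hε
    obtain ⟨rfl, rfl⟩ : m = 0 ∧ n = 0 := by omega
    rw [mem_ofOrderLE_zero] at *
    intro r x
    simp only [Module.End.mul_apply, hε r x, hδ r]
  | succ N ih =>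
    intro m n h δ ε hδ hε
    rw [mem_ofOrderLE_succ]
    intro r
    have key : δ * ε * LinearMap.mulLeft K r - LinearMap.mulLeft K r * (δ * ε)
        = δ * (ε * LinearMap.mulLeft K r - LinearMap.mulLeft K r * ε)
          + (δ * LinearMap.mulLeft K r - LinearMap.mulLeft K r * δ) * ε := by
      simp only [mul_sub, sub_mul, mul_assoc]
      abel
    rw [key]
    refine Submodule.add_mem _ ?_ ?_
    · cases n with
      | zero =>
        have h0 : ε * LinearMap.mulLeft K r - LinearMap.mulLeft K r * ε = 0 := by
          ext x
          simp [mem_ofOrderLE_zero.1 hε r x]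
        rw [h0, mul_zero]
        exact Submodule.zero_mem _
      | succ n => exact ih m n (by omega) hδ (mem_ofOrderLE_succ.1 hε r)
    · cases m with
      | zero =>
        have h0 : δ * LinearMap.mulLeft K r - LinearMap.mulLeft K r * δ = 0 := by
          ext x
          simp [mem_ofOrderLE_zero.1 hδ r x]
        rw [h0, zero_mul]
        exact Submodule.zero_mem _
      | succ m => exact ih m n (by omega) (mem_ofOrderLE_succ.1 hδ r) hε

variable (K R)

/-- The ring `D_{R|K}` of `K`-linear differential operators on `R`, with composition as
multiplication. -/
def diffOps : Subalgebra K (Module.End K R) where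
  carrier := {δ | ∃ n, δ ∈ ofOrderLE K R n}
  mul_mem' := by
    rintro a b ⟨m, hm⟩ ⟨n, hn⟩
    exact ⟨m + n, mul_mem_ofOrderLE _ m n rfl hm hn⟩
  add_mem' := by
    rintro a b ⟨m, hm⟩ ⟨n, hn⟩
    exact ⟨max m n, Submodule.add_mem _ (ofOrderLE_mono (le_max_left m n) hm)
      (ofOrderLE_mono (le_max_right m n) hn)⟩
  algebraMap_mem' := by
    intro c
    refine ⟨0, ?_⟩
    rw [mem_ofOrderLE_zero]
    intro r x
    simp [Module.algebraMap_end_apply]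

variable {K R}

/-- The order of a differential operator: the least `n` such that it has order at most `n`. -/
noncomputable def order (δ : diffOps K R) : ℕ :=
  sInf {n | (δ : Module.End K R) ∈ ofOrderLE K R n}

variable (K) in
/-- An element of `R` regarded as a differential operator of order zero. -/
def mulOp (f : R) : diffOps K R :=
  ⟨LinearMap.mulLeft K f, 0, mulLeft_mem_ofOrderLE f⟩

end Operators

section Filtrations

variable {K R : Type*} [Field K] [CommRing R] [Algebra K R]

/-- The homogeneous component of integer degree `j` of an `ℕ`-graded ring; it is zero for
negative `j`. -/
def component (𝒜 : ℕ → Submodule K R) : ℤ → Submodule K R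
  | Int.ofNat m => 𝒜 m
  | Int.negSucc _ => ⊥

/-- `δ` is homogeneous of degree `d`: it maps the component of degree `k` into that of degree
`k + d`, for every `k`. -/
def IsHomogeneousOfDegree (𝒜 : ℕ → Submodule K R) (d : ℤ) (δ : diffOps K R) : Prop :=
  ∀ (k : ℕ), ∀ r ∈ 𝒜 k, (δ : Module.End K R) r ∈ component 𝒜 (k + d)

/-- The Bernstein filtration with slope `w` on `D_{R|K}`: its `i`-th term is the `K`-span of the
homogeneous operators `δ` with `deg δ + w * ord δ ≤ i`. -/
noncomputable def bernsteinFiltration (𝒜 : ℕ → Submodule K R) (w : ℤ) (i : ℕ) :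
    Submodule K (diffOps K R) :=
  Submodule.span K {δ | ∃ d : ℤ, IsHomogeneousOfDegree 𝒜 d δ ∧ d + w * (order δ : ℤ) ≤ (i : ℤ)}

/-- Linear simplicity of a `K`-algebra `A` with a filtration `F`: there is a constant `C` such that
`1 ∈ F^{Ct} r F^{Ct}` for every `t` and every nonzero `r ∈ F^t`. The products are products of
`K`-subspaces, that is, spans of products of elements. -/
def LinearlySimple {A : Type*} [Semiring A] [Algebra K A] (F : ℕ → Submodule K A) : Prop :=
  ∃ C : ℕ, ∀ t : ℕ, ∀ r ∈ F t, r ≠ 0 →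
    (1 : A) ∈ F (C * t) * Submodule.span K {r} * F (C * t)

/-- The filtration on `A ⊗ Aᵒᵖ` whose `i`-th term is `F^i ⊗ F^i`, that is, the span of the tensors
`a ⊗ b` with `a` and `b` in `F^i`. -/
noncomputable def boxFiltration {A : Type*} [Semiring A] [Algebra K A] (F : ℕ → Submodule K A) (i : ℕ) :
    Submodule K (TensorProduct K A Aᵐᵒᵖ) :=
  Submodule.map₂ (TensorProduct.mk K A Aᵐᵒᵖ) (F i)
    ((F i).map (MulOpposite.opLinearEquiv K).toLinearMap)

end Filtrations

section Sandwich

variable {K R : Type*} [Field K] [CommRing R] [Algebra K R]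

/-- `b` satisfies a sandwich Bernstein-Sato equation
`∑ i, α_i(s) f^(s+1) β_i(s) = b(s) f^s` for `f`, with `α_i, β_i ∈ D_{R|K}[s]`: the equality of
differential operators (with composition as product) holds for every `s = n ∈ ℕ`. -/
def SatisfiesSBS (f : R) (b : Polynomial K) : Prop :=
  ∃ (m : ℕ) (α β : Fin m → Polynomial (diffOps K R)), ∀ n : ℕ,
    ∑ i, (α i).eval (n : diffOps K R) * mulOp K f ^ (n + 1) * (β i).eval (n : diffOps K R)
      = b.eval (n : K) • mulOp K f ^ n

/-- The ideal of all polynomials that satisfy a sandwich Bernstein-Sato equation for `f`. -/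
def sbsIdeal (f : R) : Ideal (Polynomial K) where
  carrier := {b | SatisfiesSBS f b}
  zero_mem' := ⟨0, Fin.elim0, Fin.elim0, by intro n; simp⟩
  add_mem' := by
    rintro b c ⟨m, α, β, h⟩ ⟨m', α', β', h'⟩
    refine ⟨m + m', Fin.append α α', Fin.append β β', fun n => ?_⟩
    rw [Fin.sum_univ_add]
    simp only [Fin.append_left, Fin.append_right]
    rw [h n, h' n, Polynomial.eval_add, add_smul]
  smul_mem' := by
    rintro c b ⟨m, α, β, h⟩
    refine ⟨m, fun i => c.map (algebraMap K (diffOps K R)) * α i, β, fun n => ?_⟩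
    have hc : ∀ i, (c.map (algebraMap K (diffOps K R)) * α i).eval (n : diffOps K R)
        = c.eval (n : K) • (α i).eval (n : diffOps K R) := by
      intro i
      have hcomm : ∀ k, Commute ((α i).coeff k) (n : diffOps K R) :=
        fun k => (Nat.cast_commute n _).symm
      have h1 : Polynomial.eval (n : diffOps K R) (c.map (algebraMap K (diffOps K R)))
          = algebraMap K (diffOps K R) (c.eval (n : K)) := by
        rw [← map_natCast (algebraMap K (diffOps K R)) n, Polynomial.eval_map_apply]
      have h2 := Polynomial.eval₂_mul_noncomm (RingHom.id (diffOps K R)) (n : diffOps K R)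
        (p := c.map (algebraMap K (diffOps K R))) (q := α i) hcomm
      simp only [← Polynomial.eval.eq_1] at h2
      rw [h2, h1, Algebra.smul_def]
    simp only [hc, smul_mul_assoc]
    rw [← Finset.smul_sum, h n, smul_smul, smul_eq_mul, Polynomial.eval_mul]

/-- The sandwich Bernstein-Sato polynomial of `f`: the monic generator of the ideal of all
polynomials that satisfy a sandwich Bernstein-Sato equation for `f`, and `0` if that ideal is
zero. -/
noncomputable def sbsPolynomial (K : Type*) {R : Type*} [Field K] [CommRing R] [Algebra K R]
    (f : R) : Polynomial K :=
  Submodule.IsPrincipal.generator (sbsIdeal (K := K) f) *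
    Polynomial.C (Submodule.IsPrincipal.generator (sbsIdeal (K := K) f)).leadingCoeff⁻¹

end Sandwich

end DiffOp

/-! Linear simplicity of D_R is first strengthened to a density property, `Collapses`: a single sum
of two-sided multiplications, of degree linear in t, carries a whole nonzero subspace V of F^t onto
the scalars. For monomial algebras (`exists_collapses`) there are three stages. Commutators with
generators of R lower the order until V consists of multiplication operators. Commutators with the
Euler operators X_j ∂/∂X_j act diagonally on monomials, so a product of shifted ones annihilates
every exponent but one and leaves a line. Linear simplicity sends that line to the scalars.

Unlike linear simplicity, this property passes visibly to tensor products. Writing r ∈ F^t ⊗ F^t in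
a basis of the second factor and collapsing the span of its coefficients turns r into 1 ⊗ b with b ≠
0 still in F^t; a second collapse gives 1. This is part 1, and the same property survives extension
of scalars to L = K(s).

For part 2, let E be the enveloping algebra of the base change of D_R to L, acting on germs at
infinity of sequences in D_R, and let m_j be the germ of n ↦ f^(n+j). With h(i) = dim B^i, the i-th
piece of E has dimension h(i)^2, so Bernstein's inequality for linearly simple algebras
(`finrank_le_finrank_orbit_sq`) gives every nonzero E-module growth at least h. Binomial expansion
(`seqGerm_mem_map`) shows that the m_j generate with growth at most h(aN + c). If the submodules E
m_0 ⊇ E m_1 ⊇ ... decreased strictly forever, then for every k the function k h would be bounded by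
a rescaling of h, with scaling factor independent of k; polynomial growth of h forbids this. Hence
m_j ∈ E m_(j+1) for some j. Clearing denominators and shifting s by j gives a sandwich equation. -/

namespace DiffOp

open TensorProduct

/-! ### Two-sided multiplications and the collapsing property -/

section SandwichOperators

variable {K A : Type*} [Field K] [Semiring A] [Algebra K A]

/-- A filtration of an algebra by subspaces that is monotone, unital and multiplicative. -/
structure IsMulFiltration (F : ℕ → Submodule K A) : Prop where
  mono : Monotone F
  one_mem : (1 : A) ∈ F 0
  mul_mem : ∀ {i j : ℕ} {a b : A}, a ∈ F i → b ∈ F j → a * b ∈ F (i + j)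

theorem IsMulFiltration.one_mem' {F : ℕ → Submodule K A} (hF : IsMulFiltration F) (i : ℕ) :
    (1 : A) ∈ F i := hF.mono (Nat.zero_le i) hF.one_mem

/-- The span of the operators `x ↦ u * x * v` with `u` and `v` in `P`. -/
def sandwichOps (P : Submodule K A) : Submodule K (Module.End K A) :=
  Submodule.span K {Φ | ∃ u ∈ P, ∃ v ∈ P, Φ = LinearMap.mulLeftRight K (u, v)}

theorem mulLeftRight_mem_sandwichOps {P : Submodule K A} {u v : A} (hu : u ∈ P) (hv : v ∈ P) :
    LinearMap.mulLeftRight K (u, v) ∈ sandwichOps P :=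
  Submodule.subset_span ⟨u, hu, v, hv, rfl⟩

theorem IsMulFiltration.id_mem_sandwichOps {F : ℕ → Submodule K A} (hF : IsMulFiltration F)
    (i : ℕ) : (1 : Module.End K A) ∈ sandwichOps (F i) := by
  have := mulLeftRight_mem_sandwichOps (hF.one_mem' i) (hF.one_mem' i)
  convert this using 1
  ext x
  simp [LinearMap.mulLeftRight_apply]

theorem IsMulFiltration.mul_mem_sandwichOps {F : ℕ → Submodule K A} (hF : IsMulFiltration F)
    {i j : ℕ} {Φ Ψ : Module.End K A} (hΦ : Φ ∈ sandwichOps (F i)) (hΨ : Ψ ∈ sandwichOps (F j)) :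
    Φ * Ψ ∈ sandwichOps (F (i + j)) := by
  induction hΦ using Submodule.span_induction with
  | zero => simp
  | add a b _ _ ha hb => rw [add_mul]; exact add_mem ha hb
  | smul c a _ ha => rw [smul_mul_assoc]; exact Submodule.smul_mem _ _ ha
  | mem a ha =>
    obtain ⟨u, hu, v, hv, rfl⟩ := ha
    induction hΨ using Submodule.span_induction with
    | zero => simp
    | add a b _ _ ha hb => rw [mul_add]; exact add_mem ha hb
    | smul c a _ ha => rw [mul_smul_comm]; exact Submodule.smul_mem _ _ ha
    | mem b hb =>
      obtain ⟨u', hu', v', hv', rfl⟩ := hb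
      refine Submodule.subset_span ⟨u * u', hF.mul_mem hu hu', v' * v, ?_, ?_⟩
      · rw [add_comm]; exact hF.mul_mem hv' hv
      · ext x
        simp [LinearMap.mulLeftRight_apply, mul_assoc]

theorem IsMulFiltration.sandwichOps_apply_mem {F : ℕ → Submodule K A} (hF : IsMulFiltration F)
    {i j : ℕ} {Φ : Module.End K A} {x : A} (hΦ : Φ ∈ sandwichOps (F i)) (hx : x ∈ F j) :
    Φ x ∈ F (i + j + i) := by
  induction hΦ using Submodule.span_induction with
  | zero => simp
  | add a b _ _ ha hb => exact add_mem ha hb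
  | smul c a _ ha => exact Submodule.smul_mem _ _ ha
  | mem a ha =>
    obtain ⟨u, hu, v, hv, rfl⟩ := ha
    rw [LinearMap.mulLeftRight_apply]
    exact hF.mul_mem (hF.mul_mem hu hx) hv

/-- Turns a membership as in linear simplicity into an operator, which can be composed and applied
to subspaces. -/
theorem exists_sandwichOps_of_mem_mul {P : Submodule K A} {r x : A}
    (hx : x ∈ P * Submodule.span K {r} * P) : ∃ Φ ∈ sandwichOps P, Φ r = x := by
  induction hx using Submodule.mul_induction_on' with
  | add a _ b _ ha hb =>
    obtain ⟨Φ, hΦ, rfl⟩ := ha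
    obtain ⟨Ψ, hΨ, rfl⟩ := hb
    exact ⟨Φ + Ψ, add_mem hΦ hΨ, rfl⟩
  | mem_mul_mem y hy v hv =>
    induction hy using Submodule.mul_induction_on' with
    | add a _ b _ ha hb =>
      obtain ⟨Φ, hΦ, e⟩ := ha
      obtain ⟨Ψ, hΨ, e'⟩ := hb
      exact ⟨Φ + Ψ, add_mem hΦ hΨ, by rw [add_mul, ← e, ← e']; rfl⟩
    | mem_mul_mem u hu s hs =>
      obtain ⟨c, rfl⟩ := Submodule.mem_span_singleton.1 hs
      refine ⟨c • LinearMap.mulLeftRight K (u, v),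
        Submodule.smul_mem _ _ (mulLeftRight_mem_sandwichOps hu hv), ?_⟩
      simp [LinearMap.mulLeftRight_apply]

/-- Every nonzero subspace of `F t` is mapped onto the scalars by a sum of two-sided
multiplications with elements of `F (C * t)`. -/
def Collapses (F : ℕ → Submodule K A) (C : ℕ) : Prop :=
  ∀ t : ℕ, ∀ V ≤ F t, V ≠ ⊥ → ∃ Φ ∈ sandwichOps (F (C * t)), V.map Φ = Submodule.span K {1}

end SandwichOperators

/-! ### Linear simplicity of the enveloping algebra -/

section Box

variable {K A : Type*} [Field K] [Ring A] [Algebra K A] {F : ℕ → Submodule K A}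

theorem tmul_op_mem_boxFiltration {i : ℕ} {a b : A} (ha : a ∈ F i) (hb : b ∈ F i) :
    a ⊗ₜ[K] MulOpposite.op b ∈ boxFiltration F i :=
  Submodule.apply_mem_map₂ _ ha ⟨b, hb, rfl⟩

theorem isMulFiltration_boxFiltration (hF : IsMulFiltration F) :
    IsMulFiltration (boxFiltration F) where
  mono i j h := Submodule.map₂_le_map₂ (hF.mono h) (Submodule.map_mono (hF.mono h))
  one_mem := by
    rw [Algebra.TensorProduct.one_def]
    exact tmul_op_mem_boxFiltration hF.one_mem hF.one_mem
  mul_mem := by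
    intro i j x y hx hy
    have : boxFiltration F i * boxFiltration F j ≤ boxFiltration F (i + j) := by
      unfold boxFiltration
      rw [Submodule.map₂_eq_span_image2, Submodule.map₂_eq_span_image2, Submodule.span_mul_span,
        Submodule.span_le]
      rintro _ ⟨_, ⟨a, ha, _, ⟨b, hb, rfl⟩, rfl⟩, _, ⟨a', ha', _, ⟨b', hb', rfl⟩, rfl⟩, rfl⟩
      have h := tmul_op_mem_boxFiltration (K := K) (hF.mul_mem ha ha')
        (add_comm j i ▸ hF.mul_mem hb' hb)
      change _ ∈ boxFiltration F (i + j)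
      simpa using h
    exact this (Submodule.mul_mem_mul hx hy)

/-- On the first tensor factor, x ↦ u x v is two-sided multiplication by u ⊗ 1 and v ⊗ 1. -/
theorem rTensor_mem_of_mem_sandwichOps (hF : IsMulFiltration F) {i : ℕ} {Φ : Module.End K A}
    (hΦ : Φ ∈ sandwichOps (F i)) (r : A ⊗[K] Aᵐᵒᵖ) :
    Φ.rTensor Aᵐᵒᵖ r ∈ boxFiltration F i * Submodule.span K {r} * boxFiltration F i := by
  induction hΦ using Submodule.span_induction with
  | zero => simp
  | add a b _ _ ha hb => rw [LinearMap.rTensor_add]; exact add_mem ha hb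
  | smul c a _ ha => rw [LinearMap.rTensor_smul]; exact Submodule.smul_mem _ _ ha
  | mem a ha =>
    obtain ⟨u, hu, v, hv, rfl⟩ := ha
    have key : (LinearMap.mulLeftRight K (u, v)).rTensor Aᵐᵒᵖ
        = LinearMap.mulLeftRight K (u ⊗ₜ[K] MulOpposite.op 1, v ⊗ₜ[K] MulOpposite.op 1) := by
      ext x y
      simp [LinearMap.mulLeftRight_apply]
    rw [key, LinearMap.mulLeftRight_apply]
    exact Submodule.mul_mem_mul (Submodule.mul_mem_mul
      (tmul_op_mem_boxFiltration hu (hF.one_mem' i)) (Submodule.mem_span_singleton_self r))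
      (tmul_op_mem_boxFiltration hv (hF.one_mem' i))

/-- In the opposite factor u and v exchange sides, which is harmless because both range over the
same subspace. -/
theorem one_tmul_mem_of_mem_sandwichOps (hF : IsMulFiltration F) {i : ℕ} {Φ : Module.End K A}
    (hΦ : Φ ∈ sandwichOps (F i)) (b : A) :
    (1 : A) ⊗ₜ[K] MulOpposite.op (Φ b) ∈ boxFiltration F i *
      Submodule.span K {(1 : A) ⊗ₜ[K] MulOpposite.op b} * boxFiltration F i := by
  induction hΦ using Submodule.span_induction with
  | zero => simp
  | add x y _ _ hx hy =>
    rw [LinearMap.add_apply, MulOpposite.op_add, tmul_add]; exact add_mem hx hy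
  | smul c x _ hx =>
    rw [LinearMap.smul_apply, MulOpposite.op_smul, tmul_smul]; exact Submodule.smul_mem _ _ hx
  | mem a ha =>
    obtain ⟨u, hu, v, hv, rfl⟩ := ha
    have key : (1 : A) ⊗ₜ[K] MulOpposite.op (LinearMap.mulLeftRight K (u, v) b)
        = (1 : A) ⊗ₜ[K] MulOpposite.op v * (1 : A) ⊗ₜ[K] MulOpposite.op b *
          (1 : A) ⊗ₜ[K] MulOpposite.op u := by
      simp [LinearMap.mulLeftRight_apply, mul_assoc]
    rw [key]
    exact Submodule.mul_mem_mul (Submodule.mul_mem_mul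
      (tmul_op_mem_boxFiltration (hF.one_mem' i) hv) (Submodule.mem_span_singleton_self _))
      (tmul_op_mem_boxFiltration (hF.one_mem' i) hu)

/-- An element of `F t ⊗ N` is sent to a nonzero tensor `1 ⊗ b` with `b ∈ N`. -/
theorem Collapses.exists_rTensor_eq {C : ℕ} (hC : Collapses F C) {W : Type*} [AddCommGroup W]
    [Module K W] (N : Submodule K W) {t : ℕ} {r : A ⊗[K] W}
    (hr : r ∈ Submodule.map₂ (TensorProduct.mk K A W) (F t) N) (h0 : r ≠ 0) :
    ∃ Φ ∈ sandwichOps (F (C * t)), ∃ b ∈ N, b ≠ 0 ∧ Φ.rTensor W r = 1 ⊗ₜ b := by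
  classical
  let 𝓒 := Module.Basis.ofVectorSpace K N
  obtain ⟨r', rfl⟩ : ∃ r' : F t ⊗[K] N, TensorProduct.map (F t).subtype N.subtype r' = r := by
    have h : Submodule.map₂ (TensorProduct.mk K A W) (F t) N
        ≤ LinearMap.range (TensorProduct.map (F t).subtype N.subtype) := by
      rw [Submodule.map₂_le]
      intro m hm n hn
      exact ⟨(⟨m, hm⟩ : F t) ⊗ₜ (⟨n, hn⟩ : N), by simp⟩
    exact h hr
  obtain ⟨a, rfl⟩ := (TensorProduct.equivFinsuppOfBasisRight (M := F t) 𝓒).symm.surjective r'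
  have ha : a ≠ 0 := by rintro rfl; simp at h0
  -- The coefficients of r in the basis `𝓒` of N. One operator must treat all of them
  -- simultaneously, which is why a property of subspaces is needed.
  let V : Submodule K A := Submodule.span K (Set.range fun l => (a l : A))
  have hV : V ≤ F t := by
    rw [Submodule.span_le]; rintro _ ⟨l, rfl⟩; exact (a l).2
  have hV0 : V ≠ ⊥ := by
    intro h
    refine ha (Finsupp.ext fun l => Subtype.ext ?_)
    have : (a l : A) ∈ V := Submodule.subset_span ⟨l, rfl⟩
    rw [h] at this
    simpa using this
  obtain ⟨Φ, hΦ, hΦV⟩ := hC t V hV hV0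
  have h1 : ∀ l, ∃ c : K, Φ (a l) = c • 1 := fun l => by
    have : Φ (a l) ∈ V.map Φ := ⟨_, Submodule.subset_span ⟨l, rfl⟩, rfl⟩
    rw [hΦV] at this
    obtain ⟨c, hc⟩ := Submodule.mem_span_singleton.1 this
    exact ⟨c, hc.symm⟩
  choose c hc using h1
  let b : N := ∑ l ∈ a.support, c l • 𝓒 l
  have hA : (1 : A) ≠ 0 := by
    intro h
    apply h0
    have : Subsingleton A := subsingleton_of_zero_eq_one h.symm
    exact Subsingleton.elim _ _
  refine ⟨Φ, hΦ, b, b.2, ?_, ?_⟩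
  · intro hb
    have hb' : b = 0 := Subtype.ext hb
    have hli := linearIndependent_iff'.1 𝓒.linearIndependent a.support c hb'
    -- If b vanished, so would every scalar Φ (a l), contradicting that Φ maps V onto the nonzero
    -- line of scalars.
    have : V.map Φ = ⊥ := by
      rw [Submodule.map_span, Submodule.span_eq_bot]
      rintro _ ⟨_, ⟨l, rfl⟩, rfl⟩
      by_cases hl : l ∈ a.support
      · simp only []; rw [hc, hli l hl, zero_smul]
      · simp only []; rw [Finsupp.notMem_support_iff.1 hl]; simp
    rw [this] at hΦV
    exact hA (Submodule.span_singleton_eq_bot.1 hΦV.symm)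
  · rw [TensorProduct.equivFinsuppOfBasisRight_symm_apply, Finsupp.sum]
    simp only [map_sum, TensorProduct.map_tmul, LinearMap.rTensor_tmul, Submodule.subtype_apply, hc]
    simp only [b, Submodule.coe_sum, tmul_sum, Submodule.coe_smul, smul_tmul]

theorem Collapses.exists_map_eq_one {C : ℕ} (hC : Collapses F C) {t : ℕ} {b : A} (hb : b ∈ F t)
    (h0 : b ≠ 0) : ∃ Φ ∈ sandwichOps (F (C * t)), Φ b = 1 := by
  obtain ⟨Φ, hΦ, h⟩ := hC t (Submodule.span K {b})
    ((Submodule.span_singleton_le_iff_mem _ _).2 hb)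
    (fun h => h0 (Submodule.span_singleton_eq_bot.1 h))
  have : (1 : A) ∈ (Submodule.span K {b}).map Φ := h ▸ Submodule.mem_span_singleton_self _
  obtain ⟨_, hx, hx1⟩ := this
  obtain ⟨c, rfl⟩ := Submodule.mem_span_singleton.1 hx
  exact ⟨c • Φ, Submodule.smul_mem _ _ hΦ, by simpa using hx1⟩

theorem Collapses.linearlySimple_boxFiltration {C : ℕ} (hF : IsMulFiltration F)
    (hC : Collapses F C) : LinearlySimple (boxFiltration F) := by
  -- One collapse for each tensor factor. The constants merely add because b lies in F t again.
  refine ⟨C + C, fun t r hr h0 => ?_⟩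
  obtain ⟨Φ, hΦ, _, ⟨b, hb, rfl⟩, hb0, e⟩ := hC.exists_rTensor_eq _ hr h0
  obtain ⟨Ψ, hΨ, e'⟩ := hC.exists_map_eq_one hb (by rintro rfl; simp at hb0)
  have h1 := rTensor_mem_of_mem_sandwichOps hF hΦ r
  have h2 := one_tmul_mem_of_mem_sandwichOps hF hΨ b
  rw [e] at h1
  rw [e'] at h2
  obtain ⟨X, hX, eX⟩ := exists_sandwichOps_of_mem_mul h1
  obtain ⟨Y, hY, eY⟩ := exists_sandwichOps_of_mem_mul h2
  have hYX := (isMulFiltration_boxFiltration hF).mul_mem_sandwichOps hY hX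
  have h3 : (Y * X) r = 1 := by
    rw [Module.End.mul_apply, eX]
    exact eY
  rw [← h3, add_mul]
  generalize Y * X = Z at hYX
  induction hYX using Submodule.span_induction with
  | zero => simp
  | add x y _ _ hx hy => exact add_mem hx hy
  | smul c x _ hx => exact Submodule.smul_mem _ _ hx
  | mem a ha =>
    obtain ⟨u, hu, v, hv, rfl⟩ := ha
    rw [LinearMap.mulLeftRight_apply]
    exact Submodule.mul_mem_mul (Submodule.mul_mem_mul hu (Submodule.mem_span_singleton_self _)) hv

end Box

/-! ### Extension of scalars -/

section BaseChange

variable {K A : Type*} [Field K] [Ring A] [Algebra K A] {F : ℕ → Submodule K A}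
variable (L : Type*) [Field L] [Algebra K L]

theorem isMulFiltration_baseChange (hF : IsMulFiltration F) :
    IsMulFiltration fun i => (F i).baseChange L where
  mono i j h := Submodule.baseChange_mono L (hF.mono h)
  one_mem := Submodule.tmul_mem_baseChange_of_mem _ hF.one_mem
  mul_mem := by
    intro i j x y hx hy
    have : (F i).baseChange L * (F j).baseChange L ≤ (F (i + j)).baseChange L := by
      rw [Submodule.baseChange_eq_span, Submodule.baseChange_eq_span, Submodule.span_mul_span,
        Submodule.span_le]
      rintro _ ⟨_, ⟨a, ha, rfl⟩, _, ⟨b, hb, rfl⟩, rfl⟩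
      simpa using Submodule.tmul_mem_baseChange_of_mem (1 : L) (hF.mul_mem ha hb)
    exact this (Submodule.mul_mem_mul hx hy)

theorem baseChange_mem_sandwichOps {P : Submodule K A} {Φ : Module.End K A}
    (hΦ : Φ ∈ sandwichOps P) : Φ.baseChange L ∈ sandwichOps (P.baseChange L) := by
  induction hΦ using Submodule.span_induction with
  | zero => simp
  | add a b _ _ ha hb => rw [LinearMap.baseChange_add]; exact add_mem ha hb
  | smul c a _ ha =>
    rw [LinearMap.baseChange_smul, ← algebraMap_smul L c]; exact Submodule.smul_mem _ _ ha
  | mem a ha =>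
    obtain ⟨u, hu, v, hv, rfl⟩ := ha
    have key : (LinearMap.mulLeftRight K (u, v)).baseChange L
        = LinearMap.mulLeftRight L ((1 : L) ⊗ₜ[K] u, (1 : L) ⊗ₜ[K] v) := by
      ext x
      simp [LinearMap.mulLeftRight_apply]
    rw [key]
    exact mulLeftRight_mem_sandwichOps (Submodule.tmul_mem_baseChange_of_mem _ hu)
      (Submodule.tmul_mem_baseChange_of_mem _ hv)

/-- Collapsing over K all coordinates of elements of V, taken in a K-basis of L, makes the extended
operator scalar-valued on V. It is nonzero there because the basis is linearly independent. -/
theorem Collapses.baseChange {C : ℕ} (hC : Collapses F C) :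
    Collapses (fun i => (F i).baseChange L) C := by
  classical
  intro t V hV hV0
  let 𝓑 := Module.Basis.ofVectorSpace K L
  let T : (Module.Basis.ofVectorSpaceIndex K L →₀ F t) → L ⊗[K] A :=
    fun a => a.sum fun l m => 𝓑 l ⊗ₜ[K] (m : A)
  have hT : ∀ x ∈ (F t).baseChange L, ∃ a, T a = x := by
    intro x hx
    obtain ⟨y, hy⟩ := Submodule.toBaseChange_surjective L (F t) ⟨x, hx⟩
    obtain ⟨a, rfl⟩ := (TensorProduct.equivFinsuppOfBasisLeft (N := F t) 𝓑).symm.surjective y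
    refine ⟨a, ?_⟩
    refine Eq.trans ?_ (congrArg Subtype.val hy)
    rw [TensorProduct.equivFinsuppOfBasisLeft_symm_apply, Finsupp.sum, map_sum,
      Submodule.coe_sum]
    rfl
  -- The K-span of all coordinates occurring in V; it stays inside F t, so the constant C is
  -- unchanged.
  let V₀ : Submodule K A := Submodule.span K {x | ∃ a, T a ∈ V ∧ ∃ l, x = a l}
  have hV₀ : V₀ ≤ F t := by
    rw [Submodule.span_le]; rintro _ ⟨a, -, l, rfl⟩; exact (a l).2
  have hV₀0 : V₀ ≠ ⊥ := by
    intro h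
    refine hV0 ((Submodule.eq_bot_iff _).2 fun x hx => ?_)
    obtain ⟨a, rfl⟩ := hT x (hV hx)
    refine Finset.sum_eq_zero fun l _ => ?_
    have : (a l : A) ∈ V₀ := Submodule.subset_span ⟨a, hx, l, rfl⟩
    rw [h, Submodule.mem_bot] at this
    simp only [this, tmul_zero]
  obtain ⟨Φ, hΦ, hΦV⟩ := hC t V₀ hV₀ hV₀0
  have hA : (1 : A) ≠ 0 := by
    intro h
    have : Subsingleton A := subsingleton_of_zero_eq_one h.symm
    exact hV₀0 (Subsingleton.elim _ _)
  have h1 : ∀ a, T a ∈ V → ∃ c : Module.Basis.ofVectorSpaceIndex K L →₀ K,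
      (∀ l, Φ (a l) = c l • 1) ∧
      Φ.baseChange L (T a) = Finsupp.linearCombination K 𝓑 c • (1 : L ⊗[K] A) := by
    intro a ha
    have h2 : ∀ l, ∃ c : K, Φ (a l) = c • 1 := fun l => by
      have : Φ (a l) ∈ V₀.map Φ := ⟨_, Submodule.subset_span ⟨a, ha, l, rfl⟩, rfl⟩
      rw [hΦV] at this
      obtain ⟨c, hc⟩ := Submodule.mem_span_singleton.1 this
      exact ⟨c, hc.symm⟩
    choose c hc using h2
    have hc0 : ∀ l, a l = 0 → c l = 0 := by
      intro l hl
      have := hc l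
      rw [hl, Submodule.coe_zero, map_zero] at this
      exact (smul_eq_zero.1 this.symm).resolve_right hA
    refine ⟨Finsupp.onFinset a.support c fun l hl => ?_, fun l => hc l, ?_⟩
    · exact Finsupp.mem_support_iff.2 fun h => hl (hc0 l h)
    · rw [Finsupp.linearCombination_apply,
        Finsupp.onFinset_sum _ (fun l => zero_smul K (𝓑 l)), Finset.sum_smul]
      simp only [T, Finsupp.sum, map_sum, LinearMap.baseChange_tmul, hc]
      refine Finset.sum_congr rfl fun l _ => ?_
      rw [Algebra.TensorProduct.one_def, smul_tmul', smul_eq_mul, mul_one, smul_tmul]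
  refine ⟨Φ.baseChange L, baseChange_mem_sandwichOps L hΦ, le_antisymm ?_ ?_⟩
  · rintro _ ⟨x, hx, rfl⟩
    obtain ⟨a, rfl⟩ := hT x (hV hx)
    obtain ⟨c, -, e⟩ := h1 a hx
    rw [e]
    exact Submodule.smul_mem _ _ (Submodule.mem_span_singleton_self _)
  · rw [Submodule.span_singleton_le_iff_mem]
    obtain ⟨a, ha, l, hl⟩ : ∃ a, T a ∈ V ∧ ∃ l, Φ (a l) ≠ 0 := by
      by_contra! h
      have : V₀.map Φ = ⊥ := by
        rw [Submodule.map_span, Submodule.span_eq_bot]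
        rintro _ ⟨_, ⟨a, ha, l, rfl⟩, rfl⟩
        exact h a ha l
      rw [this] at hΦV
      exact hA (Submodule.span_singleton_eq_bot.1 hΦV.symm)
    obtain ⟨c, hc, e⟩ := h1 a ha
    have hc0 : Finsupp.linearCombination K 𝓑 c ≠ 0 := by
      intro h
      have := linearIndependent_iff.1 𝓑.linearIndependent c h
      rw [hc, this] at hl
      simp at hl
    refine ⟨(Finsupp.linearCombination K 𝓑 c)⁻¹ • T a, V.smul_mem _ ha, ?_⟩
    rw [map_smul, e, smul_smul, inv_mul_cancel₀ hc0, one_smul]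

end BaseChange

end DiffOp

namespace DiffOp

open TensorProduct

/-! ### Bernstein's inequality and chains of submodules -/

section BernsteinInequality

variable {L E M : Type*} [Field L] [Ring E] [Algebra L E] [AddCommGroup M] [Module L M] [Module E M]
  [IsScalarTower L E M]

/-- The subspace `P m` of `M`. -/
def orbit (P : Submodule L E) (m : M) : Submodule L M :=
  P.map ((LinearMap.toSpanSingleton E M m).restrictScalars L)

instance (P : Submodule L E) (m : M) [FiniteDimensional L P] :
    FiniteDimensional L (orbit P m) := by
  unfold orbit
  infer_instance

/-- Bernstein's inequality. -/
theorem finrank_le_finrank_orbit_sq {G : ℕ → Submodule L E} (hG : IsMulFiltration G)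
    [∀ i, FiniteDimensional L (G i)] {C : ℕ}
    (hC : ∀ t : ℕ, ∀ r ∈ G t, r ≠ 0 → (1 : E) ∈ G (C * t) * Submodule.span L {r} * G (C * t))
    {m : M} (hm : m ≠ 0) (i : ℕ) :
    Module.finrank L (G i) ≤ Module.finrank L (orbit (G ((C + 1) * i)) m) ^ 2 := by
  have hmap : ∀ r : G i, ∀ x ∈ orbit (G (C * i)) m,
      Algebra.lsmul L L M (r : E) x ∈ orbit (G ((C + 1) * i)) m := by
    rintro r _ ⟨a, ha, rfl⟩
    refine ⟨r * a, ?_, ?_⟩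
    · rw [add_mul, one_mul, add_comm]
      exact hG.mul_mem r.2 ha
    · simp [mul_smul]
  -- The action of G i on the orbit of m. If r ≠ 0 acted as zero, then 1 ∈ G(Ci) r G(Ci) would
  -- annihilate m, so this map is injective and its target bounds the dimension.
  let f : G i →ₗ[L] (orbit (G (C * i)) m →ₗ[L] orbit (G ((C + 1) * i)) m) :=
    { toFun := fun r => (Algebra.lsmul L L M (r : E)).restrict (hmap r)
      map_add' := fun a b => by ext x; simp
      map_smul' := fun c a => by ext x; simp }
  have hf : Function.Injective f := by
    rw [injective_iff_map_eq_zero]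
    intro r hr
    by_contra h0
    obtain ⟨Φ, hΦ, h1⟩ := exists_sandwichOps_of_mem_mul (hC i r r.2 (fun h => h0 (Subtype.ext h)))
    have h2 : ∀ a ∈ G (C * i), (r : E) • a • m = 0 := by
      intro a ha
      have := congrArg Subtype.val (LinearMap.congr_fun hr ⟨a • m, a, ha, rfl⟩)
      simpa [f] using this
    have h3 : Φ r • m = 0 := by
      clear h1
      induction hΦ using Submodule.span_induction with
      | zero => simp
      | add a b _ _ ha hb => rw [LinearMap.add_apply, add_smul, ha, hb, add_zero]
      | smul c a _ ha => rw [LinearMap.smul_apply, smul_assoc, ha, smul_zero]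
      | mem a ha =>
        obtain ⟨u, hu, v, hv, rfl⟩ := ha
        rw [LinearMap.mulLeftRight_apply, mul_smul, mul_smul, h2 v hv, smul_zero]
    rw [h1, one_smul] at h3
    exact hm h3
  refine (LinearMap.finrank_le_finrank_of_injective hf).trans ?_
  rw [Module.finrank_linearMap, sq]
  refine Nat.mul_le_mul_right _ (Submodule.finrank_mono (Submodule.map_mono (hG.mono ?_)))
  exact Nat.mul_le_mul_right _ (Nat.le_succ C)

/-- The class of m j in N j / N (j + 1) is nonzero, so by Bernstein's inequality its orbit
contributes at least d dimensions; the k contributions add up inside X. -/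
theorem mul_le_finrank_of_chain {G : ℕ → Submodule L E} (hG : IsMulFiltration G)
    [∀ i, FiniteDimensional L (G i)] {C : ℕ}
    (hC : ∀ t : ℕ, ∀ r ∈ G t, r ≠ 0 → (1 : E) ∈ G (C * t) * Submodule.span L {r} * G (C * t))
    {i d : ℕ} (hd : d ^ 2 ≤ Module.finrank L (G i)) (X : Submodule L M) [FiniteDimensional L X]
    (k : ℕ) : ∀ (m : ℕ → M) (N : ℕ → Submodule E M), Antitone N → (∀ j, m j ∈ N j) →
      (∀ j < k, m j ∉ N (j + 1)) → (∀ j < k, orbit (G ((C + 1) * i)) (m j) ≤ X) →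
      k * d ≤ Module.finrank L (X ⊓ (N 0).restrictScalars L : Submodule L M) := by
  induction k with
  | zero => intros; simp
  | succ k ih =>
    intro m N hN hm hmN hX
    have h1 := ih (fun j => m (j + 1)) (fun j => N (j + 1)) (fun a b h => hN (by omega))
      (fun j => hm _) (fun j hj => hmN _ (by omega)) (fun j hj => hX _ (by omega))
    let Y : Submodule L M := X ⊓ (N 0).restrictScalars L
    have : FiniteDimensional L Y := Submodule.finiteDimensional_of_le inf_le_left
    let q : M →ₗ[L] M ⧸ N 1 := (N 1).mkQ.restrictScalars L
    let f : Y →ₗ[L] M ⧸ N 1 := q ∘ₗ Y.subtype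
    -- The kernel carries the induction, while the range contains the orbit of the class of m 0.
    have hker : Module.finrank L (LinearMap.ker f)
        = Module.finrank L (X ⊓ (N 1).restrictScalars L : Submodule L M) := by
      refine (Submodule.equivMapOfInjective Y.subtype Y.subtype_injective
        (LinearMap.ker f)).finrank_eq.trans ?_
      have : (LinearMap.ker f).map Y.subtype = X ⊓ (N 1).restrictScalars L := by
        ext x
        constructor
        · rintro ⟨y, hy, rfl⟩
          exact ⟨y.2.1, (Submodule.Quotient.mk_eq_zero _).1 hy⟩
        · rintro ⟨hx, hx'⟩
          exact ⟨⟨x, hx, hN (Nat.zero_le 1) hx'⟩, (Submodule.Quotient.mk_eq_zero _).2 hx', rfl⟩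
      rw [this]
    have hne : q (m 0) ≠ 0 := fun h => hmN 0 (by omega) ((Submodule.Quotient.mk_eq_zero _).1 h)
    have h2 := hd.trans (finrank_le_finrank_orbit_sq hG hC hne i)
    have h3 : orbit (G ((C + 1) * i)) (q (m 0)) ≤ LinearMap.range f := by
      rintro _ ⟨a, ha, rfl⟩
      exact ⟨⟨a • m 0, hX 0 (by omega) ⟨a, ha, rfl⟩, (N 0).smul_mem _ (hm 0)⟩, rfl⟩
    have h4 := Submodule.finrank_mono h3
    have h5 := LinearMap.finrank_range_add_finrank_ker f
    have h6 : d ≤ Module.finrank L (orbit (G ((C + 1) * i)) (q (m 0))) :=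
      (Nat.pow_le_pow_iff_left two_ne_zero).1 h2
    change _ ≤ Module.finrank L Y
    rw [← h5, hker, add_mul, one_mul]
    rw [zero_add] at h1
    omega

end BernsteinInequality

/-! ### Dimensions of filtered pieces and polynomial growth -/

section Dimensions

variable {K A : Type*} [Field K] [Ring A] [Algebra K A] {F : ℕ → Submodule K A}

theorem boxFiltration_eq_range (i : ℕ) : boxFiltration F i = LinearMap.range
    (TensorProduct.map (F i).subtype
      ((F i).map (MulOpposite.opLinearEquiv K : A ≃ₗ[K] Aᵐᵒᵖ).toLinearMap).subtype) := by
  refine le_antisymm (Submodule.map₂_le.2 fun a ha b hb => ⟨(⟨a, ha⟩ : F i) ⊗ₜ ⟨b, hb⟩, by simp⟩) ?_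
  rintro _ ⟨x, rfl⟩
  induction x with
  | zero => simp
  | add a b ha hb => rw [map_add]; exact add_mem ha hb
  | tmul a b => exact Submodule.apply_mem_map₂ _ a.2 b.2

theorem finrank_boxFiltration (i : ℕ) :
    Module.finrank K (boxFiltration F i) = Module.finrank K (F i) ^ 2 := by
  rw [boxFiltration_eq_range, LinearMap.finrank_range_of_inj, Module.finrank_tensorProduct, sq]
  · congr 1
    exact LinearEquiv.finrank_map_eq (MulOpposite.opLinearEquiv K : A ≃ₗ[K] Aᵐᵒᵖ) (F i)
  · exact TensorProduct.map_injective_of_flat_flat _ _ (Submodule.subtype_injective _)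
      (Submodule.subtype_injective _)

theorem finiteDimensional_boxFiltration (i : ℕ) [FiniteDimensional K (F i)] :
    FiniteDimensional K (boxFiltration F i) := by
  rw [boxFiltration_eq_range]
  infer_instance

theorem finrank_submodule_baseChange (L : Type*) [Field L] [Algebra K L] (P : Submodule K A) :
    Module.finrank L (P.baseChange L) = Module.finrank K P := by
  rw [← (Submodule.toBaseChange.toLinearEquiv L P).finrank_eq, Module.finrank_baseChange]

theorem finiteDimensional_submodule_baseChange (L : Type*) [Field L] [Algebra K L]
    (P : Submodule K A) [FiniteDimensional K P] : FiniteDimensional L (P.baseChange L) :=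
  Module.Finite.equiv (Submodule.toBaseChange.toLinearEquiv L P)

end Dimensions

/-- A polynomially bounded positive function cannot grow by arbitrarily large factors under
rescaling of its argument by a fixed factor. -/
theorem not_forall_mul_le_of_polynomially_bounded {h : ℕ → ℕ} (hmono : Monotone h)
    (hpos : ∀ i, 1 ≤ h i) {B D : ℕ} (hB : ∀ i, h i ≤ B * (i + 1) ^ D) (a : ℕ)
    (H : ∀ k, ∃ c, ∀ i, k * h i ≤ h (a * i + c)) : False := by
  -- The factor just exceeds (a + 1)^D. Along the arguments (a + 1)^e (c + 1), h gains it at every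
  -- step, while the polynomial bound gains only (a + 1)^D.
  obtain ⟨c, hc⟩ := H ((a + 1) ^ D + 1)
  have h1 : ∀ e, ((a + 1) ^ D + 1) ^ e ≤ h ((a + 1) ^ e * (c + 1)) := by
    intro e
    induction e with
    | zero => simpa using hpos _
    | succ e ih =>
      calc ((a + 1) ^ D + 1) ^ (e + 1) = ((a + 1) ^ D + 1) * ((a + 1) ^ D + 1) ^ e := by ring
        _ ≤ ((a + 1) ^ D + 1) * h ((a + 1) ^ e * (c + 1)) := Nat.mul_le_mul_left _ ih
        _ ≤ h (a * ((a + 1) ^ e * (c + 1)) + c) := hc _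
        _ ≤ h ((a + 1) ^ (e + 1) * (c + 1)) := hmono (by
          have : 1 ≤ (a + 1) ^ e := Nat.one_le_pow _ _ (Nat.succ_pos _)
          nlinarith [pow_succ (a + 1) e])
  have h2 : ∀ e, ((a + 1) ^ D + 1) ^ e ≤ B * (c + 2) ^ D * ((a + 1) ^ D) ^ e := by
    intro e
    refine (h1 e).trans ((hB _).trans ?_)
    rw [mul_assoc, ← pow_mul, mul_comm D e, pow_mul, ← mul_pow]
    refine Nat.mul_le_mul_left _ (Nat.pow_le_pow_left ?_ _)
    have : 1 ≤ (a + 1) ^ e := Nat.one_le_pow _ _ (Nat.succ_pos _)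
    nlinarith
  have hq : (0 : ℝ) < ((a + 1) ^ D : ℕ) := by positivity
  obtain ⟨e, he⟩ := pow_unbounded_of_one_lt ((B * (c + 2) ^ D : ℕ) : ℝ)
    (show (1 : ℝ) < (((a + 1) ^ D + 1 : ℕ) : ℝ) / ((a + 1) ^ D : ℕ) by
      rw [one_lt_div hq]; exact_mod_cast Nat.lt_succ_self _)
  rw [div_pow, lt_div_iff₀ (pow_pos hq e)] at he
  exact absurd (h2 e) (not_le.2 (by exact_mod_cast he))

/-! ### Order of differential operators -/

section Order

variable {K R : Type*} [CommRing K] [CommRing R] [Algebra K R]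

theorem order_spec (δ : diffOps K R) : (δ : Module.End K R) ∈ ofOrderLE K R (order δ) :=
  Nat.sInf_mem (s := {n | (δ : Module.End K R) ∈ ofOrderLE K R n}) δ.2

theorem order_le {δ : diffOps K R} {n : ℕ} (h : (δ : Module.End K R) ∈ ofOrderLE K R n) :
    order δ ≤ n := Nat.sInf_le h

theorem order_mul_le (δ ε : diffOps K R) : order (δ * ε) ≤ order δ + order ε :=
  order_le (mul_mem_ofOrderLE _ _ _ rfl (order_spec δ) (order_spec ε))

theorem mulOp_apply (f x : R) : (mulOp K f : Module.End K R) x = f * x := rfl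

theorem order_mulOp (f : R) : order (mulOp K f) = 0 :=
  Nat.le_zero.1 (order_le (mulLeft_mem_ofOrderLE f))

theorem mulOp_one : mulOp K (1 : R) = 1 := by
  ext x
  simp [mulOp_apply]

variable (K R) in
/-- The linear map sending an element of `R` to its multiplication operator. -/
def mulOpLinear : R →ₗ[K] diffOps K R where
  toFun := mulOp K
  map_add' f g := by ext x; simp [mulOp_apply, add_mul]
  map_smul' c f := by ext x; simp [mulOp_apply]

theorem mulOpLinear_apply (f : R) : mulOpLinear K R f = mulOp K f := rfl

theorem eq_mulOp_of_mem_ofOrderLE_zero {δ : diffOps K R}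
    (h : (δ : Module.End K R) ∈ ofOrderLE K R 0) : δ = mulOp K ((δ : Module.End K R) 1) := by
  ext x
  have := mem_ofOrderLE_zero.1 h x 1
  rw [mul_one] at this
  rw [this, mulOp_apply, mul_comm]

theorem mem_ofOrderLE_zero_of_commute {G : Set R} (hG : Algebra.adjoin K G = ⊤)
    {δ : diffOps K R} (h : ∀ g ∈ G, δ * mulOp K g = mulOp K g * δ) :
    (δ : Module.End K R) ∈ ofOrderLE K R 0 := by
  rw [mem_ofOrderLE_zero]
  intro r
  have hr : r ∈ Algebra.adjoin K G := hG ▸ trivial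
  induction hr using Algebra.adjoin_induction with
  | mem g hg => exact fun x => LinearMap.congr_fun (congrArg Subtype.val (h g hg)) x
  | algebraMap c => intro x; simp [Algebra.algebraMap_eq_smul_one]
  | add a b _ _ ha hb => intro x; rw [add_mul, map_add, ha, hb, add_mul]
  | mul a b _ _ ha hb => intro x; rw [mul_assoc, ha, hb, mul_assoc]

theorem commutator_mulOp_mem_ofOrderLE {n : ℕ} {δ : diffOps K R}
    (h : (δ : Module.End K R) ∈ ofOrderLE K R (n + 1)) (r : R) :
    ((δ * mulOp K r - mulOp K r * δ : diffOps K R) : Module.End K R) ∈ ofOrderLE K R n :=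
  mem_ofOrderLE_succ.1 h r

/-- A derivation, regarded as a differential operator. -/
def derivOp (D : Derivation K R R) : diffOps K R :=
  ⟨D, 1, by
    rw [mem_ofOrderLE_succ]
    intro r
    rw [mem_ofOrderLE_zero]
    intro s x
    simp
    ring⟩

theorem derivOp_apply (D : Derivation K R R) (x : R) : (derivOp D : Module.End K R) x = D x := rfl

end Order

/-! ### The Bernstein filtration: orders and dimensions -/

section Graded

variable {K R : Type*} [Field K] [CommRing R] [Algebra K R] {𝒜 : ℕ → Submodule K R}

theorem component_natCast (k : ℕ) : component 𝒜 (k : ℤ) = 𝒜 k := rfl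

theorem component_of_neg {z : ℤ} (hz : z < 0) : component 𝒜 z = ⊥ := by
  obtain ⟨n, rfl⟩ := Int.eq_negSucc_of_lt_zero hz
  rfl

theorem IsHomogeneousOfDegree.apply_mem {d : ℤ} {δ : diffOps K R}
    (h : IsHomogeneousOfDegree 𝒜 d δ) {z : ℤ} {r : R} (hr : r ∈ component 𝒜 z) :
    (δ : Module.End K R) r ∈ component 𝒜 (z + d) := by
  obtain hz | hz := lt_or_ge z 0
  · rw [component_of_neg hz, Submodule.mem_bot] at hr
    rw [hr, map_zero]
    exact Submodule.zero_mem _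
  · lift z to ℕ using hz
    exact h z r hr

theorem IsHomogeneousOfDegree.mul {d e : ℤ} {δ ε : diffOps K R}
    (hδ : IsHomogeneousOfDegree 𝒜 d δ) (hε : IsHomogeneousOfDegree 𝒜 e ε) :
    IsHomogeneousOfDegree 𝒜 (d + e) (δ * ε) := by
  intro k r hr
  have := hδ.apply_mem (hε.apply_mem (z := k) hr)
  rwa [add_assoc, add_comm e d] at this

theorem isHomogeneousOfDegree_one : IsHomogeneousOfDegree 𝒜 0 (1 : diffOps K R) := by
  intro k r hr
  rw [add_zero]
  exact hr

theorem IsHomogeneousOfDegree.sub {d : ℤ} {δ ε : diffOps K R}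
    (hδ : IsHomogeneousOfDegree 𝒜 d δ) (hε : IsHomogeneousOfDegree 𝒜 d ε) :
    IsHomogeneousOfDegree 𝒜 d (δ - ε) :=
  fun k r hr => sub_mem (hδ k r hr) (hε k r hr)

theorem isMulFiltration_bernsteinFiltration {w : ℤ} (hw : 0 ≤ w) :
    IsMulFiltration (bernsteinFiltration 𝒜 w) where
  mono i j hij := Submodule.span_mono fun δ ⟨d, hd, h⟩ =>
    ⟨d, hd, h.trans (by exact_mod_cast hij)⟩
  one_mem := by
    refine Submodule.subset_span ⟨0, isHomogeneousOfDegree_one, ?_⟩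
    rw [← mulOp_one, order_mulOp]
    simp
  mul_mem := by
    intro i j a b ha hb
    have : bernsteinFiltration 𝒜 w i * bernsteinFiltration 𝒜 w j
        ≤ bernsteinFiltration 𝒜 w (i + j) := by
      unfold bernsteinFiltration
      rw [Submodule.span_mul_span, Submodule.span_le]
      rintro _ ⟨δ, ⟨d, hd, h⟩, ε, ⟨e, he, h'⟩, rfl⟩
      refine Submodule.subset_span ⟨d + e, hd.mul he, ?_⟩
      have h1 : (order (δ * ε) : ℤ) ≤ order δ + order ε := by exact_mod_cast order_mul_le δ ε
      have h2 := mul_le_mul_of_nonneg_left h1 hw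
      push_cast
      linarith
    exact this (Submodule.mul_mem_mul ha hb)

theorem IsHomogeneousOfDegree.exists_mem_bernsteinFiltration {d : ℤ} {δ : diffOps K R}
    (h : IsHomogeneousOfDegree 𝒜 d δ) (w : ℤ) : ∃ c, δ ∈ bernsteinFiltration 𝒜 w c :=
  ⟨(d + w * order δ).toNat, Submodule.subset_span ⟨d, h, Int.self_le_toNat _⟩⟩

theorem IsMulFiltration.exists_sum_mem {A : Type*} [Semiring A] [Algebra K A] {F : ℕ → Submodule K A}
    (hF : IsMulFiltration F) {ι : Type*} (s : Finset ι) (a : ι → A)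
    (h : ∀ i ∈ s, ∃ c, a i ∈ F c) : ∃ c, ∑ i ∈ s, a i ∈ F c := by
  choose! c hc using h
  exact ⟨s.sup c, sum_mem fun i hi => hF.mono (Finset.le_sup hi) (hc i hi)⟩

/-- No degree is below such a w, so R is generated by the empty set, every operator has order zero,
and the slope plays no role. -/
theorem bernsteinFiltration_eq_of_nonpos {w : ℤ} (hw0 : w ≤ 0)
    (hw : Algebra.adjoin K {r : R | ∃ k : ℕ, (k : ℤ) < w ∧ r ∈ 𝒜 k} = ⊤) (w' : ℤ) :
    bernsteinFiltration 𝒜 w = bernsteinFiltration 𝒜 w' := by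
  have h0 : ∀ δ : diffOps K R, order δ = 0 := fun δ =>
    Nat.le_zero.1 (order_le (mem_ofOrderLE_zero_of_commute hw
      fun g ⟨k, hk, _⟩ => absurd hk (by omega)))
  funext i
  simp only [bernsteinFiltration, h0, Nat.cast_zero, mul_zero]

variable (𝒜) in
/-- The elements of degree at most `N`. -/
def gradeLE (N : ℕ) : Submodule K R := ⨆ k, ⨆ (_ : k ≤ N), 𝒜 k

theorem mem_gradeLE {k N : ℕ} (h : k ≤ N) {r : R} (hr : r ∈ 𝒜 k) : r ∈ gradeLE 𝒜 N :=
  (le_iSup₂_of_le (f := fun k (_ : k ≤ N) => 𝒜 k) k h le_rfl) hr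

theorem finite_and_finrank_le_of_restrict {A : Type*} [Ring A] [Algebra K A] {P : Submodule K A}
    {U V : Submodule K R} [FiniteDimensional K U] [FiniteDimensional K V]
    (g : A →ₗ[K] Module.End K R) (hmap : ∀ a ∈ P, ∀ r ∈ U, g a r ∈ V)
    (hinj : ∀ a ∈ P, (∀ r ∈ U, g a r = 0) → a = 0) :
    Module.Finite K P ∧ Module.finrank K P ≤ Module.finrank K U * Module.finrank K V := by
  let f : P →ₗ[K] (U →ₗ[K] V) :=
    { toFun := fun a => (g a).restrict (hmap a a.2)
      map_add' := fun a b => by ext x; simp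
      map_smul' := fun c a => by ext x; simp }
  have hf : Function.Injective f := (injective_iff_map_eq_zero f).2 fun a ha =>
    Subtype.ext (hinj a a.2 fun r hr => congrArg Subtype.val (LinearMap.congr_fun ha ⟨r, hr⟩))
  rw [← Module.finrank_linearMap K K]
  exact ⟨Module.Finite.of_injective f hf, LinearMap.finrank_le_finrank_of_injective hf⟩

theorem gradeLE_mono : Monotone (gradeLE 𝒜) := fun _ _ h =>
  iSup₂_le fun _ hk => fun _ hr => mem_gradeLE (hk.trans h) hr

theorem apply_mem_gradeLE {w : ℤ} (hw : 0 ≤ w) {i N : ℕ} {δ : diffOps K R}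
    (h : δ ∈ bernsteinFiltration 𝒜 w i) {r : R} (hr : r ∈ gradeLE 𝒜 N) :
    (δ : Module.End K R) r ∈ gradeLE 𝒜 (N + i) := by
  induction h using Submodule.span_induction with
  | zero => exact Submodule.zero_mem _
  | add a b _ _ ha hb => exact Submodule.add_mem _ ha hb
  | smul c a _ ha => exact Submodule.smul_mem _ c ha
  | mem δ h =>
    obtain ⟨d, hd, hi⟩ := h
    have : gradeLE 𝒜 N ≤ (gradeLE 𝒜 (N + i)).comap (δ : Module.End K R) := by
      refine iSup₂_le fun k hk r hr => ?_
      have h1 := hd k r hr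
      have h2 : 0 ≤ w * (order δ : ℤ) := by positivity
      obtain hz | hz := lt_or_ge ((k : ℤ) + d) 0
      · rw [component_of_neg hz, Submodule.mem_bot] at h1
        rw [Submodule.mem_comap, h1]
        exact Submodule.zero_mem _
      · obtain ⟨l, hl⟩ := Int.eq_ofNat_of_zero_le hz
        rw [hl] at h1
        exact mem_gradeLE (by omega) h1
    exact this hr

variable [GradedAlgebra 𝒜]

theorem isHomogeneousOfDegree_mulOp {k : ℕ} {f : R} (hf : f ∈ 𝒜 k) :
    IsHomogeneousOfDegree 𝒜 k (mulOp K f) := by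
  intro l r hr
  rw [mulOp_apply, add_comm, ← Nat.cast_add, component_natCast]
  exact SetLike.mul_mem_graded hf hr

theorem exists_mulOp_mem_bernsteinFiltration {w : ℤ} (hw : 0 ≤ w) (f : R) :
    ∃ c, mulOp K f ∈ bernsteinFiltration 𝒜 w c := by
  classical
  rw [← DirectSum.sum_support_decompose 𝒜 f, ← mulOpLinear_apply, map_sum]
  exact (isMulFiltration_bernsteinFiltration hw).exists_sum_mem _ _ fun k _ =>
    (isHomogeneousOfDegree_mulOp (SetLike.coe_mem _)).exists_mem_bernsteinFiltration w

/-- Each commutator with a generator lowers the order bound by one and raises the degree by at most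
w - 1, so the inequality is inherited. At order zero the operator is multiplication by an element of
negative degree. -/
theorem IsHomogeneousOfDegree.eq_zero_of_neg {w : ℤ} (h1w : 1 ≤ w)
    (hw : Algebra.adjoin K {r : R | ∃ k : ℕ, (k : ℤ) < w ∧ r ∈ 𝒜 k} = ⊤) (n : ℕ) :
    ∀ {d : ℤ} {δ : diffOps K R}, IsHomogeneousOfDegree 𝒜 d δ →
      (δ : Module.End K R) ∈ ofOrderLE K R n → d + (w - 1) * n < 0 → δ = 0 := by
  induction n with
  | zero =>
    intro d δ hδ hn hd
    have h1 := hδ 0 1 SetLike.GradedOne.one_mem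
    rw [component_of_neg (by simpa using hd), Submodule.mem_bot] at h1
    rw [eq_mulOp_of_mem_ofOrderLE_zero hn, h1, ← mulOpLinear_apply, map_zero]
  | succ n ih =>
    intro d δ hδ hn hd
    push_cast at hd
    have hnn : 0 ≤ (w - 1) * n := by
      have : 0 ≤ w - 1 := by linarith
      positivity
    refine ih hδ (ofOrderLE_mono (Nat.zero_le n) (mem_ofOrderLE_zero_of_commute hw ?_))
      (by linarith)
    rintro g ⟨k, hk, hg⟩
    rw [← sub_eq_zero]
    have hgh := isHomogeneousOfDegree_mulOp (K := K) hg
    refine ih (d := d + k) ((hδ.mul hgh).sub ?_) (commutator_mulOp_mem_ofOrderLE hn g)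
      (by linarith)
    rw [add_comm]
    exact hgh.mul hδ

/-- For nonzero homogeneous δ, the bound deg δ + (w - 1) ord δ ≥ 0 turns deg δ + w ord δ ≤ i into
ord δ ≤ i. This is where generators of degree strictly less than w are needed. -/
theorem mem_ofOrderLE_of_mem_bernsteinFiltration {w : ℤ} (h1w : 1 ≤ w)
    (hw : Algebra.adjoin K {r : R | ∃ k : ℕ, (k : ℤ) < w ∧ r ∈ 𝒜 k} = ⊤) {i : ℕ}
    {δ : diffOps K R} (h : δ ∈ bernsteinFiltration 𝒜 w i) :
    (δ : Module.End K R) ∈ ofOrderLE K R i := by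
  induction h using Submodule.span_induction with
  | zero => exact Submodule.zero_mem _
  | add a b _ _ ha hb => exact Submodule.add_mem _ ha hb
  | smul c a _ ha => exact Submodule.smul_mem _ c ha
  | mem δ h =>
    obtain ⟨d, hd, hi⟩ := h
    by_cases h0 : δ = 0
    · rw [h0]; exact Submodule.zero_mem _
    have h1 := mt (hd.eq_zero_of_neg h1w hw _ (order_spec δ)) h0
    exact ofOrderLE_mono (by zify; linarith) (order_spec δ)

theorem one_mem_gradeLE (N : ℕ) : (1 : R) ∈ gradeLE 𝒜 N :=
  mem_gradeLE (Nat.zero_le N) SetLike.GradedOne.one_mem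

theorem mul_mem_gradeLE {k N : ℕ} {g r : R} (hg : g ∈ 𝒜 k) (hr : r ∈ gradeLE 𝒜 N) :
    g * r ∈ gradeLE 𝒜 (k + N) := by
  have : gradeLE 𝒜 N ≤ (gradeLE 𝒜 (k + N)).comap (LinearMap.mulLeft K g) :=
    iSup₂_le fun l hl r hr => mem_gradeLE (Nat.add_le_add_left hl k) (SetLike.mul_mem_graded hg hr)
  exact this hr

/-- A differential operator of order at most `n` that vanishes on the elements of sufficiently high
degree is zero. -/
theorem eq_zero_of_vanish_on_gradeLE {D : ℕ}
    (hD : Algebra.adjoin K {r : R | ∃ k : ℕ, k ≤ D ∧ r ∈ 𝒜 k} = ⊤) (n : ℕ) :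
    ∀ {δ : diffOps K R}, (δ : Module.End K R) ∈ ofOrderLE K R n →
      (∀ r ∈ gradeLE 𝒜 (D * n), (δ : Module.End K R) r = 0) → δ = 0 := by
  induction n with
  | zero =>
    intro δ hn h
    rw [eq_mulOp_of_mem_ofOrderLE_zero hn, h 1 (one_mem_gradeLE _), ← mulOpLinear_apply, map_zero]
  | succ n ih =>
    intro δ hn h
    refine ih (ofOrderLE_mono (Nat.zero_le n) (mem_ofOrderLE_zero_of_commute hD ?_))
      fun r hr => h r (gradeLE_mono (by rw [mul_add]; omega) hr)
    rintro g ⟨k, hk, hg⟩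
    rw [← sub_eq_zero]
    -- Multiplication by g raises degree by at most D, which the extra D in D * (n + 1) absorbs.
    refine ih (commutator_mulOp_mem_ofOrderLE hn g) fun r hr => ?_
    have h1 := h (g * r) (gradeLE_mono (by rw [mul_add]; omega) (mul_mem_gradeLE hg hr))
    have h2 := h r (gradeLE_mono (by rw [mul_add]; omega) hr)
    simp [mulOp_apply, h1, h2]

/-- Operators in the i-th piece have order at most i, hence are determined by their restriction to
degrees at most D i, and they raise degree by at most i. -/
theorem exists_finrank_le {w : ℤ} (h1w : 1 ≤ w)
    (hw : Algebra.adjoin K {r : R | ∃ k : ℕ, (k : ℤ) < w ∧ r ∈ 𝒜 k} = ⊤)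
    [∀ N, FiniteDimensional K (gradeLE 𝒜 N)] :
    ∃ D : ℕ, ∀ i, Module.Finite K (bernsteinFiltration 𝒜 w i) ∧
      Module.finrank K (bernsteinFiltration 𝒜 w i)
        ≤ Module.finrank K (gradeLE 𝒜 (D * i)) * Module.finrank K (gradeLE 𝒜 (D * i + i)) := by
  refine ⟨w.toNat, fun i => ?_⟩
  have hD : Algebra.adjoin K {r : R | ∃ k : ℕ, k ≤ w.toNat ∧ r ∈ 𝒜 k} = ⊤ := by
    refine top_le_iff.1 (hw ▸ Algebra.adjoin_mono ?_)
    rintro r ⟨k, hk, hr⟩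
    exact ⟨k, by omega, hr⟩
  exact finite_and_finrank_le_of_restrict (A := diffOps K R) (P := bernsteinFiltration 𝒜 w i)
    (diffOps K R).val.toLinearMap (fun δ hδ r hr => apply_mem_gradeLE (by linarith) hδ hr)
    fun δ hδ h => eq_zero_of_vanish_on_gradeLE hD i
      (mem_ofOrderLE_of_mem_bernsteinFiltration h1w hw hδ) h

end Graded

/-! ### Homogeneous components of derivations -/

section HomogeneousComponents

variable {K R : Type*} [Field K] [CommRing R] [Algebra K R] (𝒜 : ℕ → Submodule K R)
  [GradedAlgebra 𝒜]

/-- The projection to the homogeneous component of integer degree `z`. -/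
def componentProj : ℤ → R →ₗ[K] R
  | Int.ofNat n => GradedAlgebra.proj 𝒜 n
  | Int.negSucc _ => 0

theorem componentProj_natCast (n : ℕ) (r : R) :
    componentProj 𝒜 (n : ℤ) r = DirectSum.decompose 𝒜 r n := rfl

theorem componentProj_of_neg {z : ℤ} (hz : z < 0) : componentProj 𝒜 z = 0 := by
  obtain ⟨n, rfl⟩ := Int.eq_negSucc_of_lt_zero hz
  rfl

theorem componentProj_mem (z : ℤ) (r : R) : componentProj 𝒜 z r ∈ component 𝒜 z := by
  obtain hz | hz := lt_or_ge z 0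
  · rw [componentProj_of_neg 𝒜 hz]; exact Submodule.zero_mem _
  · lift z to ℕ using hz
    exact SetLike.coe_mem _

theorem componentProj_mul {k : ℕ} {r : R} (hr : r ∈ 𝒜 k) (z : ℤ) (s : R) :
    componentProj 𝒜 (k + z) (r * s) = r * componentProj 𝒜 z s := by
  obtain hz | hz := lt_or_ge z 0
  · rw [componentProj_of_neg 𝒜 hz, LinearMap.zero_apply, mul_zero]
    obtain hz' | hz' := lt_or_ge ((k : ℤ) + z) 0
    · rw [componentProj_of_neg 𝒜 hz', LinearMap.zero_apply]
    · obtain ⟨n, hn⟩ := Int.eq_ofNat_of_zero_le hz'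
      rw [hn, componentProj_natCast]
      exact DirectSum.coe_decompose_mul_of_left_mem_of_not_le 𝒜 hr (by omega)
  · lift z to ℕ using hz
    rw [← Nat.cast_add, componentProj_natCast, componentProj_natCast]
    exact DirectSum.coe_decompose_mul_add_of_left_mem 𝒜 hr

theorem sum_componentProj {k B : ℕ} (hk : k ≤ B) {r : R}
    (hr : ∀ n, B < n → (DirectSum.decompose 𝒜 r n : R) = 0) :
    ∑ d ∈ Finset.Icc (-B : ℤ) B, componentProj 𝒜 (k + d) r = r := by
  classical
  have h1 : ∑ n ∈ Finset.range (B + 1), (DirectSum.decompose 𝒜 r n : R) = r := by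
    conv_rhs => rw [← DirectSum.sum_support_decompose 𝒜 r]
    refine (Finset.sum_subset (fun n hn => ?_) fun n _ hn => ?_).symm
    · rw [Finset.mem_range]
      by_contra h
      exact (DFinsupp.mem_support_iff.1 hn) (Subtype.ext (hr n (by omega)))
    · rw [DFinsupp.notMem_support_iff.1 hn]; rfl
  conv_rhs => rw [← h1]
  symm
  refine Finset.sum_of_injOn (fun n : ℕ => (n : ℤ) - k) (fun a _ b _ h => by simpa using h)
    (fun n hn => ?_) (fun d hd hn => ?_) (fun n _ => ?_)
  · simp at hn ⊢; omega
  · obtain hz | hz := lt_or_ge ((k : ℤ) + d) 0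
    · rw [componentProj_of_neg 𝒜 hz, LinearMap.zero_apply]
    · obtain ⟨n, hn'⟩ := Int.eq_ofNat_of_zero_le hz
      rw [hn', componentProj_natCast]
      refine hr n ?_
      by_contra h
      exact hn ⟨n, by simp; omega, by simp; omega⟩
  · rw [add_sub_cancel, componentProj_natCast]

/-- The homogeneous component of degree `d` of a linear endomorphism of a graded ring. -/
def endComponent (δ : R →ₗ[K] R) (d : ℤ) : R →ₗ[K] R :=
  DirectSum.toModule K ℕ R (fun k => componentProj 𝒜 (k + d) ∘ₗ δ ∘ₗ (𝒜 k).subtype) ∘ₗ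
    (DirectSum.decomposeLinearEquiv 𝒜).toLinearMap

theorem endComponent_apply (δ : R →ₗ[K] R) (d : ℤ) {k : ℕ} {r : R} (hr : r ∈ 𝒜 k) :
    endComponent 𝒜 δ d r = componentProj 𝒜 (k + d) (δ r) := by
  simp only [endComponent, LinearMap.comp_apply, LinearEquiv.coe_coe,
    DirectSum.decomposeLinearEquiv_apply]
  rw [DirectSum.decompose_of_mem 𝒜 hr]
  exact DirectSum.toModule_lof K k _

/-- The homogeneous component of degree `d` of a derivation of a graded ring. -/
def derivComponent (D : Derivation K R R) (d : ℤ) : Derivation K R R :=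
  Derivation.mk' (endComponent 𝒜 D d) <| by
    intro r s
    induction r using DirectSum.Decomposition.inductionOn 𝒜 with
    | zero => simp
    | add a b ha hb => rw [add_mul, map_add, ha, hb, map_add]; simp only [smul_eq_mul]; ring
    | @homogeneous k r =>
      induction s using DirectSum.Decomposition.inductionOn 𝒜 with
      | zero => simp
      | add a b ha hb => rw [mul_add, map_add, ha, hb, map_add]; simp only [smul_eq_mul]; ring
      | @homogeneous l s =>
        rw [endComponent_apply 𝒜 _ d (SetLike.mul_mem_graded r.2 s.2),
          endComponent_apply 𝒜 _ d r.2, endComponent_apply 𝒜 _ d s.2]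
        simp only [Derivation.coeFn_coe, Derivation.leibniz, map_add, smul_eq_mul]
        rw [← componentProj_mul 𝒜 r.2, ← componentProj_mul 𝒜 s.2]
        push_cast
        congr 3 <;> ring

theorem derivComponent_apply (D : Derivation K R R) (d : ℤ) {k : ℕ} {r : R} (hr : r ∈ 𝒜 k) :
    derivComponent 𝒜 D d r = componentProj 𝒜 (k + d) (D r) :=
  endComponent_apply 𝒜 _ d hr

theorem isHomogeneousOfDegree_derivComponent (D : Derivation K R R) (d : ℤ) :
    IsHomogeneousOfDegree 𝒜 d (derivOp (derivComponent 𝒜 D d)) := by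
  intro k r hr
  rw [derivOp_apply, derivComponent_apply 𝒜 D d hr]
  exact componentProj_mem 𝒜 _ _

theorem exists_finset_homogeneous_generators [Algebra.FiniteType K R] :
    ∃ s : Finset R, Algebra.adjoin K (s : Set R) = ⊤ ∧ ∀ g ∈ s, ∃ k, g ∈ 𝒜 k := by
  classical
  obtain ⟨G, hG⟩ := Algebra.FiniteType.out (R := K) (A := R)
  refine ⟨G.biUnion fun g => (DirectSum.decompose 𝒜 g).support.image
    fun k => (DirectSum.decompose 𝒜 g k : R), ?_, ?_⟩
  · rw [← top_le_iff, ← hG, Algebra.adjoin_le_iff]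
    intro g hg
    rw [← DirectSum.sum_support_decompose 𝒜 g]
    refine sum_mem fun k hk => Algebra.subset_adjoin ?_
    simp only [Finset.coe_biUnion, Set.mem_iUnion]
    exact ⟨g, hg, Finset.mem_coe.2 (Finset.mem_image_of_mem _ hk)⟩
  · simp only [Finset.mem_biUnion, Finset.mem_image]
    rintro _ ⟨g, -, k, -, rfl⟩
    exact ⟨k, SetLike.coe_mem _⟩

theorem derivation_sum_apply {ι : Type*} (s : Finset ι) (D : ι → Derivation K R R) (x : R) :
    (∑ i ∈ s, D i) x = ∑ i ∈ s, D i x := by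
  have := congrFun (map_sum (Derivation.coeFnAddMonoidHom (R := K) (A := R) (M := R)) D s) x
  rw [Finset.sum_apply] at this
  exact this

/-- The grading is arbitrary, so the Euler derivations need not be homogeneous. A derivation is
determined on finitely many homogeneous generators, hence is a finite sum of homogeneous
derivations. -/
theorem exists_derivOp_mem_bernsteinFiltration [Algebra.FiniteType K R] {w : ℤ} (hw : 0 ≤ w)
    (D : Derivation K R R) : ∃ c, derivOp D ∈ bernsteinFiltration 𝒜 w c := by
  classical
  obtain ⟨s, hs, hk⟩ := exists_finset_homogeneous_generators 𝒜
  choose! k hk using hk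
  -- Bounds the degrees of the generators and of the components of their images, so every shift lies
  -- in [-B, B].
  let B := s.sup fun g => k g ⊔ (DirectSum.decompose 𝒜 (D g)).support.sup id
  have hD : D = ∑ d ∈ Finset.Icc (-B : ℤ) B, derivComponent 𝒜 D d := by
    refine Derivation.ext_of_adjoin_eq_top _ hs fun g hg => ?_
    have hB := Finset.le_sup (f := fun g => k g ⊔ (DirectSum.decompose 𝒜 (D g)).support.sup id) hg
    rw [derivation_sum_apply]
    simp only [derivComponent_apply 𝒜 D _ (hk g hg)]
    refine (sum_componentProj 𝒜 (le_sup_left.trans hB) fun n hn => ?_).symm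
    by_contra h
    have h1 : n ∈ (DirectSum.decompose 𝒜 (D g)).support :=
      DFinsupp.mem_support_iff.2 fun h' => h (by rw [h']; rfl)
    have h2 := (Finset.le_sup (f := id) h1).trans (le_sup_right.trans hB)
    exact absurd hn (not_lt.2 h2)
  have hsum : derivOp D = ∑ d ∈ Finset.Icc (-B : ℤ) B, derivOp (derivComponent 𝒜 D d) := by
    ext x
    conv_lhs => rw [hD]
    simp [derivOp_apply, derivation_sum_apply]
  rw [hsum]
  exact (isMulFiltration_bernsteinFiltration hw).exists_sum_mem _ _ fun d _ =>
    (isHomogeneousOfDegree_derivComponent 𝒜 D d).exists_mem_bernsteinFiltration w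

end HomogeneousComponents

/-! ### Exponents bounded linearly in the degree -/

section MonomialSupport

variable {K σ : Type*} [Field K]

variable (K) in
/-- The polynomials in the variables `J` whose exponents are all at most `N`. -/
noncomputable def boxPoly (J : Finset σ) (N : ℕ) : Submodule K (MvPolynomial σ K) :=
  MvPolynomial.restrictSupport K (J.finsupp fun _ => Finset.range (N + 1) : Finset (σ →₀ ℕ))

theorem mem_boxPoly {J : Finset σ} {N : ℕ} {p : MvPolynomial σ K} :
    p ∈ boxPoly K J N ↔ ∀ m, MvPolynomial.coeff m p ≠ 0 → m.support ⊆ J ∧ ∀ j ∈ J, m j ≤ N := by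
  rw [boxPoly, MvPolynomial.mem_restrictSupport_iff]
  simp only [Set.subset_def, Finset.mem_coe, MvPolynomial.mem_support_iff, Finset.mem_finsupp_iff,
    Finset.mem_range, Nat.lt_succ_iff]

theorem boxPoly_mono (J : Finset σ) : Monotone (boxPoly K J) := by
  intro a b h p hp
  rw [mem_boxPoly] at hp ⊢
  exact fun m hm => ⟨(hp m hm).1, fun j hj => ((hp m hm).2 j hj).trans h⟩

theorem mul_mem_boxPoly {J : Finset σ} {a b : ℕ} {p q : MvPolynomial σ K}
    (hp : p ∈ boxPoly K J a) (hq : q ∈ boxPoly K J b) : p * q ∈ boxPoly K J (a + b) := by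
  classical
  rw [mem_boxPoly] at *
  intro m hm
  rw [← MvPolynomial.mem_support_iff] at hm
  obtain ⟨x, hx, y, hy, rfl⟩ := Finset.mem_add.1 (MvPolynomial.support_mul p q hm)
  rw [MvPolynomial.mem_support_iff] at hx hy
  exact ⟨Finsupp.support_add.trans (Finset.union_subset (hp x hx).1 (hq y hy).1),
    fun j hj => Nat.add_le_add ((hp x hx).2 j hj) ((hq y hy).2 j hj)⟩

theorem C_mem_boxPoly (J : Finset σ) (N : ℕ) (c : K) : MvPolynomial.C c ∈ boxPoly K J N := by
  classical
  rw [mem_boxPoly]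
  intro m hm
  rw [MvPolynomial.coeff_C] at hm
  obtain rfl : 0 = m := by by_contra h; simp [h] at hm
  simp

instance (J : Finset σ) (N : ℕ) : FiniteDimensional K (boxPoly K J N) :=
  Module.Finite.of_basis (MvPolynomial.basisRestrictSupport K _)

theorem finrank_boxPoly (J : Finset σ) (N : ℕ) :
    Module.finrank K (boxPoly K J N) = (N + 1) ^ J.card := by
  rw [boxPoly, Module.finrank_eq_card_basis (MvPolynomial.basisRestrictSupport K _)]
  simp [Finset.card_finsupp]

variable (R : Subalgebra K (MvPolynomial σ K)) (𝒜 : ℕ → Submodule K R) [GradedAlgebra 𝒜]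

/-- Exponent bounds and degrees both add under products, so it suffices to bound finitely many
homogeneous generators. This gives polynomial growth of R. -/
theorem exists_le_boxPoly [Algebra.FiniteType K R]
    (h0 : 𝒜 0 = LinearMap.range (Algebra.linearMap K R)) :
    ∃ (J : Finset σ) (M : ℕ), ∀ k, ∀ r ∈ 𝒜 k, (r : MvPolynomial σ K) ∈ boxPoly K J (M * k) := by
  classical
  obtain ⟨s, hs, hk⟩ := exists_finset_homogeneous_generators 𝒜
  choose! k hk using hk
  let J := s.biUnion fun g => (g : MvPolynomial σ K).vars
  let M := s.sup fun g => (g : MvPolynomial σ K).totalDegree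
  have hC : ∀ r ∈ 𝒜 0, ∀ N, (r : MvPolynomial σ K) ∈ boxPoly K J N := by
    intro r hr N
    rw [h0] at hr
    obtain ⟨c, rfl⟩ := hr
    exact C_mem_boxPoly J N c
  have hg : ∀ g ∈ s, (g : MvPolynomial σ K) ∈ boxPoly K J M := by
    intro g hg
    rw [mem_boxPoly]
    intro m hm
    rw [← MvPolynomial.mem_support_iff] at hm
    refine ⟨fun j hj => Finset.mem_biUnion.2 ⟨g, hg, MvPolynomial.mem_vars_iff_mem_support j |>.2 ⟨m, hm, hj⟩⟩,
      fun j hj => ?_⟩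
    exact (Finsupp.le_degree j m).trans ((MvPolynomial.le_totalDegree hm).trans
      (Finset.le_sup (f := fun g : R => (g : MvPolynomial σ K).totalDegree) hg))
  have key : ∀ r : R, ∀ n, ((DirectSum.decompose 𝒜 r n : R) : MvPolynomial σ K)
      ∈ boxPoly K J (M * n) := by
    intro r
    have hr : r ∈ Algebra.adjoin K (s : Set R) := hs ▸ trivial
    induction hr using Algebra.adjoin_induction with
    | mem g hgs =>
      intro n
      by_cases hn : k g = n
      · subst hn
        rw [DirectSum.decompose_of_mem_same 𝒜 (hk g hgs)]
        -- In degree zero the box has size 0, so 𝒜 0 = K is essential; in positive degree M ≤ M * k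
        -- g.
        obtain h | h := Nat.eq_zero_or_pos (k g)
        · exact hC g (h ▸ hk g hgs) _
        · exact boxPoly_mono J (Nat.le_mul_of_pos_right M h) (hg g hgs)
      · rw [DirectSum.decompose_of_mem_ne 𝒜 (hk g hgs) hn]
        exact Submodule.zero_mem _
    | algebraMap c =>
      intro n
      have h : algebraMap K R c ∈ 𝒜 0 := by rw [h0]; exact ⟨c, rfl⟩
      by_cases hn : 0 = n
      · subst hn
        rw [DirectSum.decompose_of_mem_same 𝒜 h]
        exact hC _ h _
      · rw [DirectSum.decompose_of_mem_ne 𝒜 h hn]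
        exact Submodule.zero_mem _
    | add a b _ _ ha hb =>
      intro n
      rw [DirectSum.decompose_add]
      exact add_mem (ha n) (hb n)
    | mul a b _ _ ha hb =>
      intro n
      rw [DirectSum.decompose_mul, DirectSum.coe_mul_apply]
      rw [AddSubmonoidClass.coe_finsetSum]
      refine Submodule.sum_mem _ fun ij hij => ?_
      have h := mul_mem_boxPoly (ha ij.1) (hb ij.2)
      rw [← mul_add, (Finset.mem_filter.1 hij).2] at h
      exact h
  refine ⟨J, M, fun n r hr => ?_⟩
  have := key r n
  rwa [DirectSum.decompose_of_mem_same 𝒜 hr] at this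

end MonomialSupport

/-! ### Euler operators on a monomial algebra -/

section EulerOperators

variable {K σ : Type*} [Field K] {R : Subalgebra K (MvPolynomial σ K)}

theorem coeff_X_mul_pderiv (j : σ) (m : σ →₀ ℕ) (p : MvPolynomial σ K) :
    MvPolynomial.coeff m (MvPolynomial.X j * MvPolynomial.pderiv j p)
      = m j * MvPolynomial.coeff m p := by
  classical
  induction p using MvPolynomial.induction_on' with
  | monomial s a =>
    rw [MvPolynomial.X_mul_pderiv_monomial, MvPolynomial.coeff_smul, MvPolynomial.coeff_monomial,
      nsmul_eq_mul]
    split_ifs with h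
    · rw [h]
    · simp
  | add p q hp hq => rw [map_add, mul_add, MvPolynomial.coeff_add, hp, hq, MvPolynomial.coeff_add,
      mul_add]

/-- Monomials are eigenvectors of this derivation, so it preserves any algebra they generate. This
is where monomial generation enters. -/
theorem X_mul_pderiv_mem {S : Set (σ →₀ ℕ)}
    (hS : R = Algebra.adjoin K ((fun m => MvPolynomial.monomial m (1 : K)) '' S)) (j : σ)
    {p : MvPolynomial σ K} (hp : p ∈ R) : MvPolynomial.X j * MvPolynomial.pderiv j p ∈ R := by
  subst hS
  induction hp using Algebra.adjoin_induction with
  | mem p hp =>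
    obtain ⟨m, hm, rfl⟩ := hp
    simp only [MvPolynomial.X_mul_pderiv_monomial]
    exact nsmul_mem (Algebra.subset_adjoin (Set.mem_image_of_mem _ hm)) _
  | algebraMap c =>
    rw [MvPolynomial.algebraMap_eq, MvPolynomial.pderiv_C, mul_zero]
    exact Subalgebra.zero_mem _
  | add p q _ _ hp hq => rw [map_add, mul_add]; exact Subalgebra.add_mem _ hp hq
  | mul p q hp' hq' hp hq =>
    rw [Derivation.leibniz, mul_add, smul_eq_mul, smul_eq_mul, mul_left_comm, mul_left_comm _ q]
    exact Subalgebra.add_mem _ (Subalgebra.mul_mem _ hp' hq) (Subalgebra.mul_mem _ hq' hp)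

/-- The Euler operator `X j * ∂ / ∂ X j` restricted to a subalgebra that it preserves. -/
noncomputable def eulerDerivation (j : σ)
    (hR : ∀ p ∈ R, MvPolynomial.X j * MvPolynomial.pderiv j p ∈ R) : Derivation K R R :=
  Derivation.mk' (A := R) (M := R)
    { toFun := fun p => ⟨MvPolynomial.X j * MvPolynomial.pderiv j p.1, hR p.1 p.2⟩
      map_add' := fun p q => Subtype.ext (by simp [mul_add])
      map_smul' := fun c p => Subtype.ext (by simp) }
    fun p q => Subtype.ext (by simp; ring)

theorem coeff_eulerDerivation (j : σ)
    (hR : ∀ p ∈ R, MvPolynomial.X j * MvPolynomial.pderiv j p ∈ R) (m : σ →₀ ℕ) (p : R) :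
    MvPolynomial.coeff m (eulerDerivation j hR p : MvPolynomial σ K)
      = m j * MvPolynomial.coeff m (p : MvPolynomial σ K) :=
  coeff_X_mul_pderiv j m p.1

end EulerOperators

/-! ### Lowering the order by commutators -/

section Collapse

variable {K R : Type*} [Field K] [CommRing R] [Algebra K R]

section Commutator

variable {A : Type*} [Semiring A] [Algebra K A]

/-- The operator `x ↦ a * x - x * a - κ • x`. -/
def shiftedCommutator (a : A) (κ : K) : Module.End K A :=
  LinearMap.mulLeftRight K (a, 1) + (-1 : K) • LinearMap.mulLeftRight K (1, a) + (-κ) • 1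

theorem shiftedCommutator_apply (a : A) (κ : K) (x : A) :
    shiftedCommutator a κ x = a * x + (-1 : K) • (x * a) + (-κ) • x := by
  simp [shiftedCommutator, LinearMap.mulLeftRight_apply]

theorem shiftedCommutator_mem {F : ℕ → Submodule K A} (hF : IsMulFiltration F) {c : ℕ} {a : A}
    (ha : a ∈ F c) (κ : K) : shiftedCommutator a κ ∈ sandwichOps (F c) :=
  add_mem (add_mem (mulLeftRight_mem_sandwichOps ha (hF.one_mem' c))
    (Submodule.smul_mem _ _ (mulLeftRight_mem_sandwichOps (hF.one_mem' c) ha)))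
    (Submodule.smul_mem _ _ (hF.id_mem_sandwichOps c))

end Commutator

theorem shiftedCommutator_mulOp_zero (g : R) (δ : diffOps K R) :
    shiftedCommutator (mulOp K g) (0 : K) δ = -(δ * mulOp K g - mulOp K g * δ) := by
  rw [shiftedCommutator_apply]
  ext x
  simp [mulOp_apply]
  ring

theorem shiftedCommutator_derivOp_mulOp (D : Derivation K R R) (κ : K) (f : R) :
    shiftedCommutator (derivOp D) κ (mulOp K f) = mulOp K (D f - κ • f) := by
  rw [shiftedCommutator_apply]
  ext x
  simp [mulOp_apply, derivOp_apply, sub_mul]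
  ring

/-- An operator commuting with all generators has order zero. So while V contains one of positive
order, some commutator with a generator does not annihilate V, and it lowers the order bound on all
of V. -/
theorem IsMulFiltration.exists_map_order_zero {F : ℕ → Submodule K (diffOps K R)}
    (hF : IsMulFiltration F) {G : Set R}
    (hG : Algebra.adjoin K G = ⊤) {c : ℕ} (hc : ∀ g ∈ G, mulOp K g ∈ F c) (n : ℕ) :
    ∀ V : Submodule K (diffOps K R), V ≠ ⊥ →
      (∀ v ∈ V, (v : Module.End K R) ∈ ofOrderLE K R n) →
      ∃ Φ ∈ sandwichOps (F (c * n)), V.map Φ ≠ ⊥ ∧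
        ∀ v ∈ V.map Φ, (v : Module.End K R) ∈ ofOrderLE K R 0 := by
  induction n with
  | zero =>
    intro V hV h
    refine ⟨1, hF.id_mem_sandwichOps _, ?_, ?_⟩
    · rwa [Module.End.one_eq_id, Submodule.map_id]
    · rwa [Module.End.one_eq_id, Submodule.map_id]
  | succ n ih =>
    intro V hV h
    -- The process must stop here: a further commutator would annihilate V.
    by_cases h0 : ∀ v ∈ V, (v : Module.End K R) ∈ ofOrderLE K R 0
    · refine ⟨1, hF.id_mem_sandwichOps _, ?_, ?_⟩
      · rwa [Module.End.one_eq_id, Submodule.map_id]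
      · rwa [Module.End.one_eq_id, Submodule.map_id]
    push Not at h0
    obtain ⟨v, hv, hv0⟩ := h0
    obtain ⟨g, hg, hvg⟩ : ∃ g ∈ G, v * mulOp K g ≠ mulOp K g * v := by
      by_contra! h'
      exact hv0 (mem_ofOrderLE_zero_of_commute hG h')
    let Ψ : Module.End K (diffOps K R) := shiftedCommutator (mulOp K g) (0 : K)
    have hΨ : ∀ x, Ψ x = -(x * mulOp K g - mulOp K g * x) := shiftedCommutator_mulOp_zero g
    have hΨm : Ψ ∈ sandwichOps (F c) := shiftedCommutator_mem hF (hc g hg) 0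
    have hVΨ : V.map Ψ ≠ ⊥ := fun h' => hvg <| by
      have h3 : Ψ v ∈ V.map Ψ := ⟨v, hv, rfl⟩
      rw [h', Submodule.mem_bot, hΨ] at h3
      exact sub_eq_zero.1 (neg_eq_zero.1 h3)
    have hn : ∀ x ∈ V.map Ψ, (x : Module.End K R) ∈ ofOrderLE K R n := by
      rintro _ ⟨x, hx, rfl⟩
      rw [hΨ]
      exact Submodule.neg_mem _ (commutator_mulOp_mem_ofOrderLE (h x hx) g)
    obtain ⟨Φ, hΦ, h1, h2⟩ := ih (V.map Ψ) hVΨ hn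
    refine ⟨Φ * Ψ, hF.mul_mem_sandwichOps hΦ hΨm, ?_, ?_⟩
    · rwa [Module.End.mul_eq_comp, Submodule.map_comp]
    · rwa [Module.End.mul_eq_comp, Submodule.map_comp]

end Collapse

/-! ### Isolating one monomial -/

section MonomialCollapse

variable {K R σ : Type*} [Field K] [CommRing R] [Algebra K R] {ι : R →ₐ[K] MvPolynomial σ K}
  {F : ℕ → Submodule K (diffOps K R)}

/-- The commutator of E j with multiplication by r is multiplication by E j r, so shifted
commutators act on coefficients by the scalars m j - n; the product of them is taken over s. -/
theorem IsMulFiltration.exists_diagonal (hF : IsMulFiltration F)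
    {E : σ → Derivation K R R}
    (hE : ∀ j m (p : R), MvPolynomial.coeff m (ι (E j p))
      = m j * MvPolynomial.coeff m (ι p))
    {J : Finset σ} {c : ℕ} (hc : ∀ j ∈ J, derivOp (E j) ∈ F c) (s : Finset ((_ : σ) × ℕ))
    (hs : ∀ p ∈ s, p.1 ∈ J) :
    ∃ Φ ∈ sandwichOps (F (c * s.card)), ∃ ψ : R →ₗ[K] R,
      (∀ r, Φ (mulOp K r) = mulOp K (ψ r)) ∧
      ∀ m r, MvPolynomial.coeff m (ι (ψ r))
        = (∏ p ∈ s, ((m p.1 : K) - p.2)) * MvPolynomial.coeff m (ι r) := by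
  classical
  induction s using Finset.induction_on with
  | empty => exact ⟨1, hF.id_mem_sandwichOps _, LinearMap.id, by simp, by simp⟩
  | insert a s ha ih =>
    obtain ⟨Φ, hΦ, ψ, h1, h2⟩ := ih fun p hp => hs p (Finset.mem_insert_of_mem hp)
    refine ⟨shiftedCommutator (derivOp (E a.1)) (a.2 : K) * Φ, ?_,
      ((E a.1 : R →ₗ[K] R) - (a.2 : K) • LinearMap.id) ∘ₗ ψ, ?_, ?_⟩
    · rw [Finset.card_insert_of_notMem ha, mul_add, mul_one, add_comm]
      exact hF.mul_mem_sandwichOps (shiftedCommutator_mem hF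
        (hc _ (hs a (Finset.mem_insert_self _ _))) _) hΦ
    · intro r
      rw [Module.End.mul_apply, h1, shiftedCommutator_derivOp_mulOp]
      rfl
    · intro m r
      rw [Finset.prod_insert ha, mul_assoc, ← h2]
      simp [hE, sub_mul]

theorem IsMulFiltration.exists_map_eq_span_mulOp [CharZero K]
    (hι : Function.Injective ι) (hF : IsMulFiltration F)
    {E : σ → Derivation K R R}
    (hE : ∀ j m (p : R), MvPolynomial.coeff m (ι (E j p))
      = m j * MvPolynomial.coeff m (ι p))
    {J : Finset σ} {c : ℕ} (hc : ∀ j ∈ J, derivOp (E j) ∈ F c) {B : ℕ}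
    {V : Submodule K (diffOps K R)} (hV0 : V ≠ ⊥)
    (hV : ∀ v ∈ V, ∃ f : R, v = mulOp K f ∧ ι f ∈ boxPoly K J B) :
    ∃ Φ ∈ sandwichOps (F (c * (J.card * B))), ∃ z : R, z ≠ 0 ∧
      V.map Φ = Submodule.span K {mulOp K z} := by
  classical
  obtain ⟨v, hv, hv0⟩ := Submodule.exists_mem_ne_zero_of_ne_bot hV0
  obtain ⟨f, rfl, hf⟩ := hV v hv
  have hf0 : ι f ≠ 0 := by
    intro h
    apply hv0
    rw [hι (h.trans (map_zero ι).symm), ← mulOpLinear_apply, map_zero]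
  obtain ⟨m, hm⟩ := MvPolynomial.ne_zero_iff.1 hf0
  -- The factors m' j - n with n ≤ B and n ≠ m j: at m none vanishes, by characteristic zero, and at
  -- any other exponent in the box one does. Erasing m j leaves B values for each j.
  let s : Finset ((_ : σ) × ℕ) := J.sigma fun j => (Finset.range (B + 1)).erase (m j)
  have hmB := mem_boxPoly.1 hf m hm
  have hcard : s.card = J.card * B := by
    rw [Finset.card_sigma, Finset.sum_congr rfl (g := fun _ => B), Finset.sum_const, smul_eq_mul]
    intro j hj
    rw [Finset.card_erase_of_mem (by simpa [Nat.lt_succ_iff] using hmB.2 j hj), Finset.card_range,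
      Nat.add_sub_cancel]
  obtain ⟨Φ, hΦ, ψ, h1, h2⟩ := hF.exists_diagonal hE hc s
    (fun p hp => (Finset.mem_sigma.1 hp).1)
  rw [hcard] at hΦ
  have hm0 : ∏ p ∈ s, ((m p.1 : K) - p.2) ≠ 0 := by
    rw [Finset.prod_ne_zero_iff]
    rintro ⟨j, n⟩ hp
    have := Finset.ne_of_mem_erase (Finset.mem_sigma.1 hp).2
    rw [sub_ne_zero]
    exact_mod_cast this.symm
  have h3 : ∀ g : R, ι g ∈ boxPoly K J B → ∀ m', m' ≠ m →
      MvPolynomial.coeff m' (ι (ψ g)) = 0 := by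
    intro g hg m' hm'
    rw [h2]
    by_cases hg0 : MvPolynomial.coeff m' (ι g) = 0
    · rw [hg0, mul_zero]
    · obtain ⟨hJ, hB⟩ := mem_boxPoly.1 hg m' hg0
      obtain ⟨j, hj⟩ := DFunLike.ne_iff.1 hm'
      have hjJ : j ∈ J := by
        by_contra hjJ
        refine hj ?_
        rw [Finsupp.notMem_support_iff.1 fun h => hjJ (hJ h),
          Finsupp.notMem_support_iff.1 fun h => hjJ (hmB.1 h)]
      rw [Finset.prod_eq_zero (i := ⟨j, m' j⟩), zero_mul]
      · exact Finset.mem_sigma.2 ⟨hjJ, Finset.mem_erase.2 ⟨hj, by simpa [Nat.lt_succ_iff] using hB j hjJ⟩⟩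
      · simp
  refine ⟨Φ, hΦ, ψ f, ?_, le_antisymm ?_ ?_⟩
  · intro h
    have := h2 m f
    rw [h] at this
    simp [hm, hm0] at this
  · rintro _ ⟨x, hx, rfl⟩
    obtain ⟨g, rfl, hg⟩ := hV x hx
    rw [h1]
    refine Submodule.mem_span_singleton.2 ⟨MvPolynomial.coeff m (ι g)
      / MvPolynomial.coeff m (ι f), ?_⟩
    rw [← mulOpLinear_apply, ← mulOpLinear_apply, ← map_smul]
    congr 1
    refine hι (MvPolynomial.ext _ _ fun m' => ?_)
    rw [map_smul, MvPolynomial.coeff_smul, smul_eq_mul]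
    by_cases hm' : m' = m
    · subst hm'
      rw [h2, h2]
      field_simp
    · rw [h3 f hf m' hm', h3 g hg m' hm', mul_zero]
  · rw [Submodule.span_singleton_le_iff_mem]
    exact ⟨_, hv, h1 f⟩

end MonomialCollapse

/-! ### The collapsing property of D_R -/

section Main

variable {K R σ : Type*} [Field K] [CharZero K] [CommRing R] [Algebra K R]
  {ι : R →ₐ[K] MvPolynomial σ K} {𝒜 : ℕ → Submodule K R} [GradedAlgebra 𝒜]

theorem exists_collapses [Algebra.FiniteType K R] (hι : Function.Injective ι)
    {E : σ → Derivation K R R}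
    (hE : ∀ j m p, MvPolynomial.coeff m (ι (E j p)) = m j * MvPolynomial.coeff m (ι p))
    {J : Finset σ} {M : ℕ} (hdeg : ∀ N, ∀ r ∈ gradeLE 𝒜 N, ι r ∈ boxPoly K J (M * N))
    {w : ℤ} (h1w : 1 ≤ w)
    (hw : Algebra.adjoin K {r : R | ∃ k : ℕ, (k : ℤ) < w ∧ r ∈ 𝒜 k} = ⊤)
    (hB : LinearlySimple (bernsteinFiltration 𝒜 w)) :
    ∃ C, Collapses (bernsteinFiltration 𝒜 w) C := by
  classical
  have hw0 : 0 ≤ w := by linarith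
  have hF := isMulFiltration_bernsteinFiltration (𝒜 := 𝒜) hw0
  obtain ⟨G, hG⟩ := Algebra.FiniteType.out (R := K) (A := R)
  choose a ha using exists_mulOp_mem_bernsteinFiltration (𝒜 := 𝒜) hw0
  choose b hb using fun j => exists_derivOp_mem_bernsteinFiltration 𝒜 hw0 (E j)
  obtain ⟨C, hC⟩ := hB
  let c := G.sup a
  let e := J.sup b
  have hc : ∀ g ∈ (G : Set R), mulOp K g ∈ bernsteinFiltration 𝒜 w c := fun g hg =>
    hF.mono (Finset.le_sup hg) (ha g)
  have he : ∀ j ∈ J, derivOp (E j) ∈ bernsteinFiltration 𝒜 w e := fun j hj =>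
    hF.mono (Finset.le_sup hj) (hb j)
  -- The first stage costs c t and leaves V in degree (2c + 1) t. Applied to 1, these operators give
  -- polynomials with exponents at most M (2c + 1) t, so the second stage costs q t and puts z in
  -- degree (2q + 2c + 1) t, where linear simplicity costs C times that.
  let q := e * (J.card * (M * (c + 1 + c)))
  refine ⟨C * (q + (c + 1 + c) + q) + (q + c), fun t V hV hV0 => ?_⟩
  obtain ⟨Φ₁, hΦ₁, h1, h2⟩ := hF.exists_map_order_zero hG hc t V hV0
    fun v hv => mem_ofOrderLE_of_mem_bernsteinFiltration h1w hw (hV hv)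
  have h3 : V.map Φ₁ ≤ bernsteinFiltration 𝒜 w ((c + 1 + c) * t) := by
    rintro _ ⟨v, hv, rfl⟩
    have := hF.sandwichOps_apply_mem hΦ₁ (hV hv)
    convert this using 2
    ring
  obtain ⟨Φ₂, hΦ₂, z, hz0, h4⟩ := IsMulFiltration.exists_map_eq_span_mulOp
    hι hF hE he (B := M * ((c + 1 + c) * t)) h1 fun v hv =>
      ⟨_, eq_mulOp_of_mem_ofOrderLE_zero (h2 v hv), hdeg _ _ (by
        have := apply_mem_gradeLE hw0 (h3 hv) (one_mem_gradeLE (𝒜 := 𝒜) 0)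
        rwa [zero_add] at this)⟩
  have hq : e * (J.card * (M * ((c + 1 + c) * t))) = q * t := by simp only [q]; ring
  rw [hq] at hΦ₂
  have h5 : mulOp K z ∈ bernsteinFiltration 𝒜 w ((q + (c + 1 + c) + q) * t) := by
    have : mulOp K z ∈ (V.map Φ₁).map Φ₂ := h4 ▸ Submodule.mem_span_singleton_self _
    obtain ⟨v, hv, h⟩ := this
    rw [← h]
    have := hF.sandwichOps_apply_mem hΦ₂ (h3 hv)
    convert this using 2
    ring
  have h6 : mulOp K z ≠ 0 := fun h => hz0 (by
    have := LinearMap.congr_fun (congrArg Subtype.val h) 1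
    simpa [mulOp_apply] using this)
  obtain ⟨Φ₃, hΦ₃, h7⟩ := exists_sandwichOps_of_mem_mul (hC _ _ h5 h6)
  refine ⟨Φ₃ * (Φ₂ * Φ₁), ?_, ?_⟩
  · have := hF.mul_mem_sandwichOps hΦ₃ (hF.mul_mem_sandwichOps hΦ₂ hΦ₁)
    convert this using 3
    ring
  · rw [Module.End.mul_eq_comp, Module.End.mul_eq_comp, Submodule.map_comp, Submodule.map_comp, h4,
      Submodule.map_span, Set.image_singleton, h7]

end Main

end DiffOp

namespace DiffOp

open TensorProduct Filter Polynomial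

/-! ### The enveloping algebra acting by two-sided multiplication -/

section SandwichModule

variable {L 𝔸 M : Type*} [Field L] [Ring 𝔸] [Algebra L 𝔸] [Ring M] [Algebra L M]

/-- The two-sided multiplication action on an algebra over `𝔸`. -/
noncomputable def sandwichAction (ψ : 𝔸 →ₐ[L] M) : 𝔸 ⊗[L] 𝔸ᵐᵒᵖ →ₐ[L] Module.End L M :=
  (AlgHom.mulLeftRight L M).comp (Algebra.TensorProduct.map ψ (AlgHom.op ψ))

theorem sandwichAction_tmul (ψ : 𝔸 →ₐ[L] M) (x y : 𝔸) (u : M) :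
    sandwichAction ψ (x ⊗ₜ MulOpposite.op y) u = ψ x * u * ψ y := by
  simp [sandwichAction, AlgHom.mulLeftRight_apply]

variable {K A : Type*} [Field K] [Ring A] [Algebra K A] [Algebra K L]

theorem sandwichAction_mem (ψ : L ⊗[K] A →ₐ[L] M) {F : ℕ → Submodule K A} {N : ℕ} {u : M}
    {Y : Submodule L M} (h : ∀ a ∈ F N, ∀ b ∈ F N, ψ (1 ⊗ₜ a) * u * ψ (1 ⊗ₜ b) ∈ Y)
    {e : (L ⊗[K] A) ⊗[L] (L ⊗[K] A)ᵐᵒᵖ}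
    (he : e ∈ boxFiltration (fun i => (F i).baseChange L) N) : sandwichAction ψ e u ∈ Y := by
  have hle : boxFiltration (fun i => (F i).baseChange L) N
      ≤ Y.comap (LinearMap.applyₗ u ∘ₗ (sandwichAction ψ).toLinearMap) := by
    refine Submodule.map₂_le.2 ?_
    rintro x hx _ ⟨y, hy, rfl⟩
    change sandwichAction ψ (x ⊗ₜ MulOpposite.op y) u ∈ Y
    rw [sandwichAction_tmul]
    simp only [SetLike.mem_coe, Submodule.baseChange_eq_span] at hx hy
    induction hx using Submodule.span_induction with
    | zero => simp
    | add x x' _ _ hx hx' => rw [map_add, add_mul, add_mul]; exact add_mem hx hx'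
    | smul c x _ hx => rw [map_smul, smul_mul_assoc, smul_mul_assoc]; exact Y.smul_mem c hx
    | mem x hx =>
      obtain ⟨a, ha, rfl⟩ := hx
      induction hy using Submodule.span_induction with
      | zero => simp
      | add x x' _ _ hx hx' => rw [map_add, mul_add]; exact add_mem hx hx'
      | smul c x _ hx => rw [map_smul, mul_smul_comm]; exact Y.smul_mem c hx
      | mem y hy =>
        obtain ⟨b, hb, rfl⟩ := hy
        exact h a ha b hb
  exact hle he

theorem sandwichAction_mem_of_forall (ψ : L ⊗[K] A →ₐ[L] M) {u : M}
    {Y : Submodule L M} (h : ∀ a b : A, ψ (1 ⊗ₜ a) * u * ψ (1 ⊗ₜ b) ∈ Y)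
    (e : (L ⊗[K] A) ⊗[L] (L ⊗[K] A)ᵐᵒᵖ) : sandwichAction ψ e u ∈ Y := by
  refine sandwichAction_mem ψ (F := fun _ => ⊤) (N := 0) (fun a _ b _ => h a b) ?_
  have : boxFiltration (fun _ => (⊤ : Submodule K A).baseChange L) 0 = ⊤ := by
    rw [boxFiltration, Submodule.baseChange_top, Submodule.map_top, LinearEquiv.range,
      TensorProduct.map₂_mk_top_top_eq_top]
  rw [this]
  trivial

end SandwichModule

/-! ### Germs of sequences as an algebra over K(s) -/

section Germs

/-- Germs at infinity of sequences in `A`. -/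
def SeqGerm (A : Type*) : Type _ := Germ (atTop : Filter ℕ) A

noncomputable instance (A : Type*) [Ring A] : Ring (SeqGerm A) :=
  inferInstanceAs (Ring (Germ (atTop : Filter ℕ) A))

noncomputable instance (A : Type*) [CommRing A] : CommRing (SeqGerm A) :=
  inferInstanceAs (CommRing (Germ (atTop : Filter ℕ) A))

/-- The germ at infinity of a sequence. -/
noncomputable def seqGerm {A : Type*} [Ring A] : (ℕ → A) →+* SeqGerm A :=
  Germ.coeRingHom (atTop : Filter ℕ)

theorem seqGerm_eq_iff {A : Type*} [Ring A] {u v : ℕ → A} :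
    seqGerm u = seqGerm v ↔ ∀ᶠ n in atTop, u n = v n := Germ.coe_eq

theorem seqGerm_surjective {A : Type*} [Ring A] :
    Function.Surjective (seqGerm : (ℕ → A) → SeqGerm A) := fun x => by
  induction x using Germ.inductionOn with
  | _ u => exact ⟨u, rfl⟩

variable {K A : Type*} [Field K] [Ring A] [Algebra K A]

/-- The map on germs induced by the structure map of an algebra. -/
noncomputable def SeqGerm.mapAlgebra : SeqGerm K →+* SeqGerm A where
  toFun := Germ.map (algebraMap K A)
  map_one' := by
    change Germ.map _ (seqGerm 1) = seqGerm 1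
    exact seqGerm_eq_iff.2 (Eventually.of_forall fun n => by simp)
  map_zero' := by
    change Germ.map _ (seqGerm 0) = seqGerm 0
    exact seqGerm_eq_iff.2 (Eventually.of_forall fun n => by simp)
  map_mul' x y := by
    obtain ⟨u, rfl⟩ := seqGerm_surjective x
    obtain ⟨v, rfl⟩ := seqGerm_surjective y
    exact seqGerm_eq_iff.2 (Eventually.of_forall fun n => by simp)
  map_add' x y := by
    obtain ⟨u, rfl⟩ := seqGerm_surjective x
    obtain ⟨v, rfl⟩ := seqGerm_surjective y
    exact seqGerm_eq_iff.2 (Eventually.of_forall fun n => by simp)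

/-- The germ of the sequence of values of a polynomial at the natural numbers. -/
noncomputable def polyGerm : K[X] →+* SeqGerm K :=
  seqGerm.comp (RingHom.pi fun n : ℕ => Polynomial.evalRingHom (n : K))

theorem polyGerm_apply (p : K[X]) : polyGerm p = seqGerm fun n : ℕ => p.eval (n : K) := rfl

noncomputable instance : Algebra K (SeqGerm A) :=
  RingHom.toAlgebra' (SeqGerm.mapAlgebra.comp (seqGerm.comp (Pi.constRingHom ℕ K))) fun c x => by
    obtain ⟨u, rfl⟩ := seqGerm_surjective x
    exact seqGerm_eq_iff.2 (Eventually.of_forall fun n => Algebra.commutes c (u n))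

variable (K A) in
/-- Constant sequences. -/
noncomputable def constGerm : A →ₐ[K] SeqGerm A :=
  { (seqGerm.comp (Pi.constRingHom ℕ A) : A →+* SeqGerm A) with
    commutes' := fun _ => rfl }

variable [CharZero K]

theorem eventually_eval_natCast_ne_zero {p : K[X]} (hp : p ≠ 0) :
    ∀ᶠ n : ℕ in atTop, p.eval (n : K) ≠ 0 := by
  classical
  have h : {n : ℕ | p.eval (n : K) = 0}.Finite :=
    (p.roots.toFinset.finite_toSet.preimage Nat.cast_injective.injOn).subset fun n hn => by
      simpa [hp] using hn
  rw [← Nat.cofinite_eq_atTop]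
  exact h.compl_mem_cofinite

/-- In characteristic zero a nonzero polynomial has only finitely many natural roots. Passing to
germs ignores these, which lets rational functions in s act by evaluation. -/
theorem isUnit_polyGerm (p : nonZeroDivisors K[X]) : IsUnit (polyGerm (p : K[X])) := by
  refine IsUnit.of_mul_eq_one (seqGerm fun n : ℕ => ((p : K[X]).eval (n : K))⁻¹) ?_
  rw [polyGerm_apply, ← map_mul, ← map_one seqGerm, seqGerm_eq_iff]
  filter_upwards [eventually_eval_natCast_ne_zero (nonZeroDivisors.ne_zero p.2)] with n hn
  exact mul_inv_cancel₀ hn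

noncomputable instance : Algebra (FractionRing K[X]) (SeqGerm A) :=
  RingHom.toAlgebra' (SeqGerm.mapAlgebra.comp
      (IsLocalization.lift (M := nonZeroDivisors K[X]) isUnit_polyGerm)) fun c x => by
    obtain ⟨u, rfl⟩ := seqGerm_surjective x
    rw [RingHom.comp_apply]
    obtain ⟨v, hv⟩ := seqGerm_surjective
      (IsLocalization.lift (M := nonZeroDivisors K[X]) isUnit_polyGerm c)
    rw [← hv]
    exact seqGerm_eq_iff.2 (Eventually.of_forall fun n => Algebra.commutes (v n) (u n))

theorem algebraMap_seqGerm (p : K[X]) :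
    algebraMap (FractionRing K[X]) (SeqGerm A) (algebraMap K[X] _ p)
      = seqGerm fun n : ℕ => algebraMap K A (p.eval (n : K)) := by
  change SeqGerm.mapAlgebra (IsLocalization.lift _ _) = _
  rw [IsLocalization.lift_eq]
  rfl

theorem algebraMap_smul_seqGerm (p : K[X]) (u : ℕ → A) :
    algebraMap K[X] (FractionRing K[X]) p • seqGerm u = seqGerm fun n : ℕ => p.eval (n : K) • u n := by
  rw [Algebra.smul_def, algebraMap_seqGerm, ← map_mul]
  congr 1
  ext n
  simp [Algebra.smul_def]

instance : IsScalarTower K (FractionRing K[X]) (SeqGerm A) :=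
  IsScalarTower.of_algebraMap_eq fun c => by
    rw [IsScalarTower.algebraMap_apply K K[X] (FractionRing K[X]), algebraMap_seqGerm]
    simp only [Polynomial.algebraMap_apply, Algebra.algebraMap_self, RingHom.id_apply,
      Polynomial.eval_C]
    rfl

variable (K A) in
/-- The canonical map from the base change of `A` to `K(s)` to germs of sequences in `A`. -/
noncomputable def baseChangeGerm : FractionRing K[X] ⊗[K] A →ₐ[FractionRing K[X]] SeqGerm A :=
  Algebra.TensorProduct.lift (Algebra.ofId _ _) (constGerm K A) fun l a =>
    show Commute _ _ from Algebra.commutes l (constGerm K A a)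

theorem baseChangeGerm_tmul (l : FractionRing K[X]) (a : A) :
    baseChangeGerm K A (l ⊗ₜ a) = l • seqGerm fun _ => a := by
  rw [Algebra.smul_def]
  exact Algebra.TensorProduct.lift_tmul _ _ _ _ _

end Germs

/-! ### Moving powers past operators -/

section Commutation

variable {K A : Type*} [Field K] [Ring A] [Algebra K A]

/-- The inner derivation `b ↦ φ * b - b * φ`. -/
def innerDeriv (φ : A) : A →ₗ[K] A := LinearMap.mulLeft K φ - LinearMap.mulRight K φ

/-- Left multiplication by φ is the sum of the commuting maps `innerDeriv φ` and right
multiplication by φ, so the binomial theorem applies. The range of summation does not depend on n: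
terms with l > n have zero binomial coefficient, so the truncated n - l is harmless. -/
theorem pow_mul_eq_sum (φ b : A) {N : ℕ} (hb : ∀ l, N < l → (innerDeriv (K := K) φ ^ l) b = 0)
    (n : ℕ) : φ ^ n * b = ∑ l ∈ Finset.range (N + 1),
      n.choose l • ((innerDeriv (K := K) φ ^ l) b * φ ^ (n - l)) := by
  have hc : Commute (innerDeriv (K := K) φ) (LinearMap.mulRight K φ) := by
    refine Commute.sub_left ?_ (Commute.refl _)
    exact LinearMap.commute_mulLeft_right φ φ
  have h1 : ∀ l, (LinearMap.mulRight K φ ^ l) = LinearMap.mulRight K (φ ^ l) := fun l =>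
    LinearMap.pow_mulRight K A φ l
  have h2 : φ ^ n * b = ∑ l ∈ Finset.range (n + 1),
      n.choose l • ((innerDeriv (K := K) φ ^ l) b * φ ^ (n - l)) := by
    have h3 := hc.add_pow n
    rw [innerDeriv, sub_add_cancel, LinearMap.pow_mulLeft] at h3
    have h4 := LinearMap.congr_fun h3 b
    rw [LinearMap.mulLeft_apply] at h4
    rw [h4, LinearMap.sum_apply]
    refine Finset.sum_congr rfl fun l _ => ?_
    rw [← innerDeriv, (hc.pow_pow l (n - l)).eq, h1, ← nsmul_eq_mul']
    simp
  have h5 : ∀ l, l ∉ Finset.range (n + 1) ∨ l ∉ Finset.range (N + 1) →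
      n.choose l • ((innerDeriv (K := K) φ ^ l) b * φ ^ (n - l)) = 0 := by
    rintro l (h | h)
    · rw [Nat.choose_eq_zero_of_lt (by simpa using h), zero_smul]
    · rw [hb l (by simpa using h), zero_mul, smul_zero]
  rw [h2]
  obtain h | h := le_total n N
  · exact Finset.sum_subset (Finset.range_mono (by omega)) fun l _ hl => h5 l (Or.inl hl)
  · exact (Finset.sum_subset (Finset.range_mono (by omega)) fun l _ hl => h5 l (Or.inr hl)).symm

theorem IsMulFiltration.innerDeriv_pow_mem {F : ℕ → Submodule K A} (hF : IsMulFiltration F)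
    {c i : ℕ} {φ b : A} (hφ : φ ∈ F c) (hb : b ∈ F i) (l : ℕ) :
    (innerDeriv (K := K) φ ^ l) b ∈ F (i + l * c) := by
  induction l with
  | zero => simpa using hb
  | succ l ih =>
    rw [pow_succ', Module.End.mul_apply, add_mul, one_mul, ← add_assoc]
    refine sub_mem ?_ (hF.mul_mem ih hφ)
    rw [add_comm]
    exact hF.mul_mem hφ ih

theorem IsMulFiltration.pow_mem {F : ℕ → Submodule K A} (hF : IsMulFiltration F)
    {c : ℕ} {φ : A} (hφ : φ ∈ F c) (l : ℕ) : φ ^ l ∈ F (l * c) := by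
  induction l with
  | zero => simpa using hF.one_mem
  | succ l ih => rw [pow_succ, add_mul, one_mul]; exact hF.mul_mem ih hφ

end Commutation

end DiffOp

namespace DiffOp

open TensorProduct Filter Polynomial

/-! ### Stabilization of the chain of submodules by growth -/

section Growth

variable {L E M : Type*} [Field L] [Ring E] [Algebra L E] [AddCommGroup M] [Module L M]

/-- If the filtered pieces of the module generated by each `m j` grow like a polynomially bounded
function, then some `m j` lies in the submodule generated by `m (j + 1)`. -/
theorem exists_apply_eq_of_growth {G : ℕ → Submodule L E} (hG : IsMulFiltration G)
    (hfin : ∀ i, Module.Finite L (G i)) (hsimple : LinearlySimple G) (Θ : E →ₐ[L] Module.End L M)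
    {h : ℕ → ℕ} (hmono : Monotone h) (hpos : ∀ i, 1 ≤ h i) {B D : ℕ}
    (hB : ∀ i, h i ≤ B * (i + 1) ^ D) (hh : ∀ i, h i ^ 2 ≤ Module.finrank L (G i)) (m : ℕ → M)
    (hm : ∀ j, ∃ e, Θ e (m j) = m (j + 1)) (a : ℕ)
    (hX : ∀ k, ∃ c, ∀ N, ∃ X : Submodule L M, Module.Finite L X ∧
      Module.finrank L X ≤ h (a * N + c) ∧ ∀ j < k, ∀ e ∈ G N, Θ e (m j) ∈ X) :
    ∃ j e, Θ e (m (j + 1)) = m j := by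
  obtain ⟨C, hC⟩ := hsimple
  let : Module E M := Module.compHom M Θ.toRingHom
  have hact : ∀ (e : E) (x : M), e • x = Θ e x := fun e x => rfl
  have : IsScalarTower L E M := ⟨fun l e x => by rw [hact, hact, map_smul]; rfl⟩
  by_contra! hne
  -- The scaling factor a (C + 1) is the same for all k; only the additive constant may depend on k.
  refine not_forall_mul_le_of_polynomially_bounded hmono hpos hB (a * (C + 1)) fun k => ?_
  obtain ⟨c, hc⟩ := hX k
  refine ⟨c, fun i => ?_⟩
  obtain ⟨X, hX, hXh, hmX⟩ := hc ((C + 1) * i)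
  have h1 := mul_le_finrank_of_chain hG hC (hh i) X k m (fun j => Submodule.span E {m j})
    (antitone_nat_of_succ_le fun j => by
      rw [Submodule.span_singleton_le_iff_mem, Submodule.mem_span_singleton]
      exact hm j)
    (fun j => Submodule.mem_span_singleton_self _)
    (fun j _ h => by
      obtain ⟨e, he⟩ := Submodule.mem_span_singleton.1 h
      exact hne j e he)
    (fun j hj => by
      rintro _ ⟨e, he, rfl⟩
      exact hmX j hj e he)
  rw [mul_assoc]
  exact h1.trans ((Submodule.finrank_mono inf_le_left).trans hXh)

end Growth

/-! ### Growth of the submodules generated by powers -/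

section BinomialExpansion

variable {K A : Type*} [Field K] [CharZero K] [Ring A] [Algebra K A]

variable (K) in
/-- The polynomial whose value at `n` is the binomial coefficient `(n + j).choose l`. -/
noncomputable def choosePoly (j l : ℕ) : K[X] :=
  C ((Nat.factorial l : K)⁻¹) * (descPochhammer K l).comp (X + C (j : K))

theorem choosePoly_eval (j l n : ℕ) :
    (choosePoly K j l).eval (n : K) = ((n + j).choose l : K) := by
  rw [choosePoly, Polynomial.eval_mul, Polynomial.eval_comp, Nat.cast_choose_eq_descPochhammer_div]
  simp [div_eq_inv_mul]

/-- Moving φ^(n + j) to the right of b gives coefficients polynomial in n and the common right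
factor φ^(n - N). The remaining factors have degrees N, N + l c and (N + j - l) c, whose sum is at
most (2 + c) N + c k. -/
theorem seqGerm_mem_map {F : ℕ → Submodule K A} (hF : IsMulFiltration F) {φ : A} {c : ℕ}
    (hφ : φ ∈ F c)
    (had : ∀ i, ∀ b ∈ F i, ∀ l, i < l → (innerDeriv (K := K) φ ^ l) b = 0)
    {N j k : ℕ} (hj : j ≤ k) {a b : A} (ha : a ∈ F N) (hb : b ∈ F N) :
    seqGerm (fun n => a * φ ^ (n + j) * b) ∈
      (((F ((2 + c) * N + c * k)).baseChange (FractionRing K[X])).map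
        (LinearMap.mulRight (FractionRing K[X]) (seqGerm fun n => φ ^ (n - N)) ∘ₗ
          (baseChangeGerm K A).toLinearMap)) := by
  refine ⟨∑ l ∈ Finset.range (N + 1), algebraMap K[X] (FractionRing K[X]) (choosePoly K j l) ⊗ₜ
    (a * (innerDeriv (K := K) φ ^ l) b * φ ^ (N + j - l)), sum_mem fun l hl => ?_, ?_⟩
  · refine Submodule.tmul_mem_baseChange_of_mem _ ?_
    have hl' : l ≤ N := Nat.lt_succ_iff.1 (Finset.mem_range.1 hl)
    refine hF.mono ?_ (hF.mul_mem (hF.mul_mem ha (hF.innerDeriv_pow_mem hφ hb l))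
      (hF.pow_mem hφ (N + j - l)))
    obtain ⟨d, rfl⟩ := Nat.exists_eq_add_of_le hl'
    obtain ⟨e, rfl⟩ := Nat.exists_eq_add_of_le hj
    rw [show l + d + j - l = d + j by omega]
    nlinarith [Nat.zero_le (c * e)]
  · rw [LinearMap.comp_apply, AlgHom.toLinearMap_apply, map_sum, LinearMap.mulRight_apply]
    simp only [baseChangeGerm_tmul, algebraMap_smul_seqGerm]
    rw [← map_sum, ← map_mul, seqGerm_eq_iff]
    -- Splitting φ^(n + j - l) as φ^(N + j - l) φ^(n - N) requires n ≥ N, so the identity holds only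
    -- for germs.
    filter_upwards [eventually_ge_atTop N] with n hn
    rw [mul_assoc a, pow_mul_eq_sum (K := K) φ b (had N b hb) (n + j), Pi.mul_apply,
      Finset.sum_apply, Finset.sum_mul, Finset.mul_sum]
    refine Finset.sum_congr rfl fun l hl => ?_
    have hl' : l ≤ N := Nat.lt_succ_iff.1 (Finset.mem_range.1 hl)
    rw [choosePoly_eval, Nat.cast_smul_eq_nsmul, smul_mul_assoc, mul_smul_comm]
    congr 1
    simp only [mul_assoc, ← pow_add]
    congr 3
    omega

end BinomialExpansion

/-! ### Sandwich functional equations -/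

section Sandwich

variable {K A : Type*} [Field K] [Ring A] [Algebra K A]

/-- The sequences `n ↦ ∑ i, α i (n) • (a i * v n * b i)` with polynomials `α i`. -/
def IsSandwichSum (v u : ℕ → A) : Prop :=
  ∃ (m : ℕ) (α : Fin m → K[X]) (a b : Fin m → A), ∀ n : ℕ,
    u n = ∑ i, (α i).eval (n : K) • (a i * v n * b i)

theorem IsSandwichSum.add {v u u' : ℕ → A} (h : IsSandwichSum (K := K) v u)
    (h' : IsSandwichSum (K := K) v u') : IsSandwichSum (K := K) v (u + u') := by
  obtain ⟨m, α, a, b, h⟩ := h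
  obtain ⟨m', α', a', b', h'⟩ := h'
  refine ⟨m + m', Fin.append α α', Fin.append a a', Fin.append b b', fun n => ?_⟩
  rw [Fin.sum_univ_add, Pi.add_apply, h, h']
  simp only [Fin.append_left, Fin.append_right]

theorem IsSandwichSum.smul {v u : ℕ → A} (h : IsSandwichSum (K := K) v u) (p : K[X]) :
    IsSandwichSum (K := K) v (fun n => p.eval (n : K) • u n) := by
  obtain ⟨m, α, a, b, h⟩ := h
  refine ⟨m, fun i => p * α i, a, b, fun n => ?_⟩
  simp only [h, Finset.smul_sum, Polynomial.eval_mul, mul_smul]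

variable [CharZero K]

/-- The germs which become germs of sandwich sums after multiplication by a nonzero polynomial. -/
noncomputable def sandwichGerms (v : ℕ → A) : Submodule (FractionRing K[X]) (SeqGerm A) where
  carrier := {x | ∃ p : K[X], p ≠ 0 ∧ ∃ u, IsSandwichSum (K := K) v u ∧
    algebraMap K[X] (FractionRing K[X]) p • x = seqGerm u}
  zero_mem' := ⟨1, one_ne_zero, 0, ⟨0, Fin.elim0, Fin.elim0, Fin.elim0, by simp⟩, by simp⟩
  add_mem' := by
    rintro x y ⟨p, hp, u, hu, e⟩ ⟨q, hq, u', hu', e'⟩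
    refine ⟨p * q, mul_ne_zero hp hq, _, (hu.smul q).add (hu'.smul p), ?_⟩
    rw [map_add, ← algebraMap_smul_seqGerm, ← algebraMap_smul_seqGerm, ← e, ← e', smul_add, map_mul,
      smul_smul, smul_smul, mul_comm (algebraMap K[X] (FractionRing K[X]) q)]
  smul_mem' := by
    rintro l x ⟨p, hp, u, hu, e⟩
    obtain ⟨⟨r, s⟩, hl⟩ := IsLocalization.surj (nonZeroDivisors K[X]) l
    refine ⟨s * p, mul_ne_zero (nonZeroDivisors.ne_zero s.2) hp, _, hu.smul r, ?_⟩
    rw [← algebraMap_smul_seqGerm, ← e, ← hl, smul_smul, smul_smul, map_mul]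
    congr 1
    ring

theorem seqGerm_mem_sandwichGerms (v : ℕ → A) (a b : A) :
    seqGerm (fun n => a * v n * b) ∈ sandwichGerms (K := K) v :=
  ⟨1, one_ne_zero, fun n => a * v n * b, ⟨1, fun _ => 1, fun _ => a, fun _ => b, by simp⟩,
    by rw [map_one, one_smul]⟩

/-- A sandwich functional equation that holds for large `n` and with shift `j` yields one that
holds for all `n`. -/
theorem exists_sandwich_of_mem_sandwichGerms {φ : A} {j : ℕ}
    (h : seqGerm (fun n => φ ^ (n + j)) ∈ sandwichGerms (K := K) fun n => φ ^ (n + (j + 1))) :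
    ∃ p : K[X], p ≠ 0 ∧ ∃ (m : ℕ) (α : Fin m → K[X]) (a b : Fin m → A), ∀ n : ℕ,
      ∑ i, (α i).eval (n : K) • (a i * φ ^ (n + 1) * b i) = p.eval (n : K) • φ ^ n := by
  obtain ⟨p, hp, u, ⟨m, α, a, b, hu⟩, e⟩ := h
  rw [algebraMap_smul_seqGerm, seqGerm_eq_iff, eventually_atTop] at e
  obtain ⟨n₀, hn₀⟩ := e
  -- Vanishes at the finitely many n for which the shifted equation is not known; replacing s by s -
  -- j undoes the shift.
  let q : K[X] := ∏ l ∈ Finset.range (n₀ + j), (X - C (l : K))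
  refine ⟨q * p.comp (X - C (j : K)), mul_ne_zero ?_ ?_, m,
    fun i => q * (α i).comp (X - C (j : K)), a, b, fun n => ?_⟩
  · exact Finset.prod_ne_zero_iff.2 fun l _ => Polynomial.X_sub_C_ne_zero _
  · intro h
    have := congrArg (fun f => Polynomial.comp f (X + C (j : K))) h
    simp only [Polynomial.comp_assoc, Polynomial.sub_comp, Polynomial.X_comp, Polynomial.C_comp,
      add_sub_cancel_right, Polynomial.comp_X, Polynomial.zero_comp] at this
    exact hp this
  · obtain hn | hn := lt_or_ge n (n₀ + j)
    · have hq : q.eval (n : K) = 0 := by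
        rw [Polynomial.eval_prod]
        exact Finset.prod_eq_zero (Finset.mem_range.2 hn) (by simp)
      simp [hq]
    · obtain ⟨d, rfl⟩ := Nat.exists_eq_add_of_le hn
      have h1 := hn₀ (n₀ + d) (Nat.le_add_right _ _)
      rw [hu] at h1
      have h2 : ((n₀ + j + d : ℕ) : K) - (j : K) = ((n₀ + d : ℕ) : K) := by push_cast; ring
      simp only [Polynomial.eval_mul, Polynomial.eval_comp, Polynomial.eval_sub, Polynomial.eval_X,
        Polynomial.eval_C, h2, mul_smul]
      rw [← Finset.smul_sum, show n₀ + j + d = n₀ + d + j by omega, h1]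
      rfl

-- The growth argument applied to the germs of φ^(n + j), over the enveloping algebra of the base
-- change of A to K(s), with h the dimension function of F. The nilpotency hypothesis plays the role
-- of the order bound.
set_option maxHeartbeats 1000000 in
theorem exists_sandwich_equation [Nontrivial A] {F : ℕ → Submodule K A} (hF : IsMulFiltration F)
    [∀ i, FiniteDimensional K (F i)] {C : ℕ} (hC : Collapses F C) {B D : ℕ}
    (hB : ∀ i, Module.finrank K (F i) ≤ B * (i + 1) ^ D) {φ : A} {c : ℕ} (hφ : φ ∈ F c)
    (had : ∀ i, ∀ b ∈ F i, ∀ l, i < l → (innerDeriv (K := K) φ ^ l) b = 0) :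
    ∃ p : K[X], p ≠ 0 ∧ ∃ (m : ℕ) (α : Fin m → K[X]) (a b : Fin m → A), ∀ n : ℕ,
      ∑ i, (α i).eval (n : K) • (a i * φ ^ (n + 1) * b i) = p.eval (n : K) • φ ^ n := by
  let L := FractionRing K[X]
  let FL : ℕ → Submodule L (L ⊗[K] A) := fun i => (F i).baseChange L
  have hFL : IsMulFiltration FL := isMulFiltration_baseChange L hF
  have hG := isMulFiltration_boxFiltration hFL
  have : ∀ i, FiniteDimensional L (FL i) := fun i => finiteDimensional_submodule_baseChange L (F i)
  let m : ℕ → SeqGerm A := fun j => seqGerm fun n => φ ^ (n + j)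
  have hsand : ∀ (a b : A) (j : ℕ), baseChangeGerm K A (1 ⊗ₜ a) * m j * baseChangeGerm K A (1 ⊗ₜ b)
      = seqGerm fun n => a * φ ^ (n + j) * b := by
    intro a b j
    rw [baseChangeGerm_tmul, baseChangeGerm_tmul, one_smul, one_smul, ← map_mul, ← map_mul]
    rfl
  obtain ⟨j, e, he⟩ : ∃ j e, sandwichAction (baseChangeGerm K A) e (m (j + 1)) = m j := by
    refine exists_apply_eq_of_growth hG (fun i => finiteDimensional_boxFiltration i)
      ((hC.baseChange L).linearlySimple_boxFiltration hFL) (sandwichAction (baseChangeGerm K A))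
      (h := fun i => Module.finrank K (F i)) (fun i j h => Submodule.finrank_mono (hF.mono h))
      (fun i => ?_) hB (fun i => ?_) m (fun j => ⟨(1 ⊗ₜ 1) ⊗ₜ MulOpposite.op (1 ⊗ₜ φ), ?_⟩) (2 + c)
      fun k => ⟨c * k, fun N => ⟨((F ((2 + c) * N + c * k)).baseChange L).map
        (LinearMap.mulRight L (seqGerm fun n => φ ^ (n - N)) ∘ₗ (baseChangeGerm K A).toLinearMap),
        ?_, ?_, fun j hj e he => ?_⟩⟩
    · rw [Nat.one_le_iff_ne_zero, Ne, Submodule.finrank_eq_zero]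
      intro h
      have := hF.one_mem' i
      rw [h] at this
      exact one_ne_zero this
    · rw [finrank_boxFiltration, finrank_submodule_baseChange]
    · rw [sandwichAction_tmul, hsand]
      congr 1
      ext n
      rw [one_mul, ← pow_succ, add_assoc]
    · have := finiteDimensional_submodule_baseChange L (F ((2 + c) * N + c * k))
      exact Module.Finite.map _ _
    · have := finiteDimensional_submodule_baseChange L (F ((2 + c) * N + c * k))
      exact (Submodule.finrank_map_le _ _).trans (finrank_submodule_baseChange L _).le
    · refine sandwichAction_mem (baseChangeGerm K A) (fun a ha b hb => ?_) he
      rw [hsand]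
      exact seqGerm_mem_map hF hφ had hj.le ha hb
  refine exists_sandwich_of_mem_sandwichGerms (j := j) ?_
  change m j ∈ _
  rw [← he]
  refine sandwichAction_mem_of_forall _ (fun a b => ?_) e
  rw [hsand]
  exact seqGerm_mem_sandwichGerms _ a b

end Sandwich

/-! ### Transfer to semirings -/

section Semiring

variable {K A : Type*} [Field K] [Semiring A] [Algebra K A] {F : ℕ → Submodule K A}

/-- A semiring that is an algebra over a field has negatives, given by the scalar -1, so the results
for rings apply. -/
theorem linearlySimple_boxFiltration_of_collapses (hF : IsMulFiltration F) {C : ℕ}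
    (hC : Collapses F C) : LinearlySimple (boxFiltration F) :=
  let : Ring A := Algebra.semiringToRing K
  Collapses.linearlySimple_boxFiltration hF hC

theorem exists_sandwich_equation_of_collapses [CharZero K] [Nontrivial A] (hF : IsMulFiltration F)
    (hfin : ∀ i, Module.Finite K (F i)) {C : ℕ} (hC : Collapses F C) {B D : ℕ}
    (hB : ∀ i, Module.finrank K (F i) ≤ B * (i + 1) ^ D) {φ : A} {c : ℕ} (hφ : φ ∈ F c)
    (had : ∀ i, ∀ b ∈ F i, ∀ l, i < l → (shiftedCommutator φ (0 : K) ^ l) b = 0) :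
    ∃ p : Polynomial K, p ≠ 0 ∧ ∃ (m : ℕ) (α : Fin m → Polynomial K) (a b : Fin m → A), ∀ n : ℕ,
      ∑ i, (α i).eval (n : K) • (a i * φ ^ (n + 1) * b i) = p.eval (n : K) • φ ^ n := by
  let : Ring A := Algebra.semiringToRing K
  have h : innerDeriv (K := K) φ = shiftedCommutator φ (0 : K) := by
    ext x
    simp [innerDeriv, shiftedCommutator_apply, sub_eq_add_neg]
  exact exists_sandwich_equation hF hC hB hφ (h ▸ had)

end Semiring

/-! ### From sandwich equations to the Bernstein–Sato polynomial -/

section Assembly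

variable {K R : Type*} [Field K] [CommRing R] [Algebra K R]

theorem sbsPolynomial_ne_zero {f : R} {p : Polynomial K} (hp : p ≠ 0) (h : SatisfiesSBS f p) :
    sbsPolynomial K f ≠ 0 := by
  have hI : sbsIdeal (K := K) f ≠ ⊥ := fun h' => by
    have : p ∈ sbsIdeal (K := K) f := h
    rw [h'] at this
    exact hp this
  have hg : Submodule.IsPrincipal.generator (sbsIdeal (K := K) f) ≠ 0 := fun h' =>
    hI ((Submodule.IsPrincipal.eq_bot_iff_generator_eq_zero _).2 h')
  exact mul_ne_zero hg (Polynomial.C_ne_zero.2 (inv_ne_zero (Polynomial.leadingCoeff_ne_zero.2 hg)))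

theorem satisfiesSBS_of_sum_eq {f : R} {p : Polynomial K} {m : ℕ} {α : Fin m → Polynomial K}
    {a b : Fin m → diffOps K R} (h : ∀ n : ℕ, ∑ i, (α i).eval (n : K) •
      (a i * mulOp K f ^ (n + 1) * b i) = p.eval (n : K) • mulOp K f ^ n) : SatisfiesSBS f p := by
  refine ⟨m, fun i => (α i).map (algebraMap K (diffOps K R)) * Polynomial.C (a i),
    fun i => Polynomial.C (b i), fun n => ?_⟩
  rw [← h n]
  refine Finset.sum_congr rfl fun i _ => ?_
  rw [Polynomial.eval_C]
  have h1 : Polynomial.eval (n : diffOps K R) ((α i).map (algebraMap K (diffOps K R)))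
      = algebraMap K (diffOps K R) ((α i).eval (n : K)) := by
    rw [← map_natCast (algebraMap K (diffOps K R)) n, Polynomial.eval_map_apply]
  have h2 := Polynomial.eval₂_mul_noncomm (RingHom.id (diffOps K R)) (n : diffOps K R)
    (p := (α i).map (algebraMap K (diffOps K R))) (q := Polynomial.C (a i))
    fun k => (Nat.cast_commute n _).symm
  simp only [← Polynomial.eval.eq_1, Polynomial.eval_C] at h2
  rw [h2, h1, ← Algebra.smul_def, smul_mul_assoc, smul_mul_assoc]

theorem shiftedCommutator_mulOp_pow_eq_zero (f : R) (n : ℕ) : ∀ {δ : diffOps K R},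
    (δ : Module.End K R) ∈ ofOrderLE K R n → ∀ l, n < l →
      (shiftedCommutator (mulOp K f) (0 : K) ^ l) δ = 0 := by
  induction n with
  | zero =>
    intro δ hδ l hl
    obtain ⟨l, rfl⟩ := Nat.exists_eq_succ_of_ne_zero hl.ne'
    have h0 : shiftedCommutator (mulOp K f) (0 : K) δ = 0 := by
      rw [shiftedCommutator_mulOp_zero]
      ext x
      simp [mulOp_apply, mem_ofOrderLE_zero.1 hδ f x]
    rw [pow_succ, Module.End.mul_apply, h0, map_zero]
  | succ n ih =>
    intro δ hδ l hl
    obtain ⟨l, rfl⟩ := Nat.exists_eq_succ_of_ne_zero (Nat.ne_zero_of_lt hl)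
    rw [pow_succ, Module.End.mul_apply]
    refine ih ?_ l (by omega)
    rw [shiftedCommutator_mulOp_zero]
    exact Submodule.neg_mem _ (commutator_mulOp_mem_ofOrderLE hδ f)

variable {σ : Type*} [CharZero K] [Nontrivial R] {ι : R →ₐ[K] MvPolynomial σ K}
  {𝒜 : ℕ → Submodule K R} [GradedAlgebra 𝒜]

theorem linearlySimple_boxFiltration_and_sbsPolynomial_ne_zero [Algebra.FiniteType K R]
    (hι : Function.Injective ι) {E : σ → Derivation K R R}
    (hE : ∀ j m p, MvPolynomial.coeff m (ι (E j p)) = m j * MvPolynomial.coeff m (ι p))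
    {J : Finset σ} {M : ℕ} (hdeg : ∀ N, ∀ r ∈ gradeLE 𝒜 N, ι r ∈ boxPoly K J (M * N))
    {w : ℤ} (h1w : 1 ≤ w)
    (hw : Algebra.adjoin K {r : R | ∃ k : ℕ, (k : ℤ) < w ∧ r ∈ 𝒜 k} = ⊤)
    (hB : LinearlySimple (bernsteinFiltration 𝒜 w)) :
    LinearlySimple (boxFiltration (bernsteinFiltration 𝒜 w)) ∧ ∀ f : R, sbsPolynomial K f ≠ 0 := by
  have hw0 : 0 ≤ w := by linarith
  have hF := isMulFiltration_bernsteinFiltration (𝒜 := 𝒜) hw0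
  obtain ⟨C, hC⟩ := exists_collapses hι hE hdeg h1w hw hB
  refine ⟨linearlySimple_boxFiltration_of_collapses hF hC, fun f => ?_⟩
  let g : ∀ N, gradeLE 𝒜 N →ₗ[K] boxPoly K J (M * N) := fun N =>
    ι.toLinearMap.restrict fun r hr => hdeg N r hr
  have hg : ∀ N, Function.Injective (g N) := fun N r s h =>
    Subtype.ext (hι (congrArg Subtype.val h))
  have : ∀ N, FiniteDimensional K (gradeLE 𝒜 N) := fun N => Module.Finite.of_injective (g N) (hg N)
  have hle : ∀ N, Module.finrank K (gradeLE 𝒜 N) ≤ (M * N + 1) ^ J.card := fun N => by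
    rw [← finrank_boxPoly (K := K)]
    exact LinearMap.finrank_le_finrank_of_injective (hg N)
  obtain ⟨D, hD⟩ := exists_finrank_le h1w hw
  -- Source and target of the restriction maps embed in boxes of side linear in i with J.card
  -- variables, hence the exponent 2 J.card.
  have hpoly : ∀ i, Module.finrank K (bernsteinFiltration 𝒜 w i)
      ≤ ((M * (D + 1) + 1) ^ J.card) ^ 2 * (i + 1) ^ (J.card * 2) := by
    intro i
    have h1 : M * (D * i) + 1 ≤ (M * (D + 1) + 1) * (i + 1) := by nlinarith [Nat.zero_le (M * i)]
    have h2 : M * (D * i + i) + 1 ≤ (M * (D + 1) + 1) * (i + 1) := by nlinarith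
    calc Module.finrank K (bernsteinFiltration 𝒜 w i)
        ≤ (M * (D * i) + 1) ^ J.card * (M * (D * i + i) + 1) ^ J.card :=
          (hD i).2.trans (Nat.mul_le_mul (hle _) (hle _))
      _ ≤ ((M * (D + 1) + 1) * (i + 1)) ^ J.card * ((M * (D + 1) + 1) * (i + 1)) ^ J.card :=
          Nat.mul_le_mul (Nat.pow_le_pow_left h1 _) (Nat.pow_le_pow_left h2 _)
      _ = _ := by rw [mul_pow, pow_mul]; ring
  obtain ⟨c, hc⟩ := exists_mulOp_mem_bernsteinFiltration (𝒜 := 𝒜) hw0 f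
  obtain ⟨p, hp, m, α, a, b, h⟩ := exists_sandwich_equation_of_collapses hF (fun i => (hD i).1) hC
    hpoly hc fun i δ hδ => shiftedCommutator_mulOp_pow_eq_zero f i
      (mem_ofOrderLE_of_mem_bernsteinFiltration h1w hw hδ)
  exact sbsPolynomial_ne_zero hp (satisfiesSBS_of_sum_eq h)

end Assembly

end DiffOp

theorem mainTheorem5 {K σ : Type*} [Field K] [CharZero K]
    (R : Subalgebra K (MvPolynomial σ K)) (hfg : R.FG)
    (S : Set (σ →₀ ℕ))
    (hS : R = Algebra.adjoin K ((fun m => MvPolynomial.monomial m (1 : K)) '' S))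
    (𝒜 : ℕ → Submodule K R) [GradedAlgebra 𝒜]
    (h0 : 𝒜 0 = LinearMap.range (Algebra.linearMap K R))
    (w : ℤ) (hw : Algebra.adjoin K {r : R | ∃ k : ℕ, (k : ℤ) < w ∧ r ∈ 𝒜 k} = ⊤)
    (hB : DiffOp.LinearlySimple (DiffOp.bernsteinFiltration 𝒜 w)) :
    DiffOp.LinearlySimple (DiffOp.boxFiltration (DiffOp.bernsteinFiltration 𝒜 w)) ∧
      ∀ f : R, f ≠ 0 → DiffOp.sbsPolynomial K f ≠ 0 := by
  have : Algebra.FiniteType K R := R.fg_iff_finiteType.1 hfg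
  -- For w ≤ 0 the filtration is independent of the slope, so w may be replaced by 1; the set of
  -- allowed generators only grows.
  wlog h1w : 1 ≤ w generalizing w
  · have h := DiffOp.bernsteinFiltration_eq_of_nonpos (by omega) hw 1
    rw [h] at hB ⊢
    refine this 1 (top_le_iff.1 (hw ▸ Algebra.adjoin_mono ?_)) hB le_rfl
    rintro r ⟨k, hk, hr⟩
    exact ⟨k, by omega, hr⟩
  have hE := fun j p hp => DiffOp.X_mul_pderiv_mem (K := K) hS j (p := p) hp
  obtain ⟨J, M, hJM⟩ := DiffOp.exists_le_boxPoly R 𝒜 h0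
  have hdeg : ∀ N, ∀ r ∈ DiffOp.gradeLE 𝒜 N, R.val r ∈ DiffOp.boxPoly K J (M * N) := by
    intro N
    have : DiffOp.gradeLE 𝒜 N ≤ (DiffOp.boxPoly K J (M * N)).comap R.val.toLinearMap :=
      iSup₂_le fun k hk r hr => DiffOp.boxPoly_mono J (Nat.mul_le_mul_left M hk) (hJM k r hr)
    exact this
  obtain ⟨h1, h2⟩ := DiffOp.linearlySimple_boxFiltration_and_sbsPolynomial_ne_zero (ι := R.val)
    (E := fun j => DiffOp.eulerDerivation j (hE j))
    Subtype.val_injective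
    (fun j m p => DiffOp.coeff_eulerDerivation j (hE j) m p)
    hdeg h1w hw hB
  exact ⟨h1, fun f _ => h2 f⟩
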